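/- Let $\mathrm{Im}\,\tau>0$, $\Lambda=\mathbb Z+\tau\mathbb Z$, let $\wp$ be the Weierstrass function of $\Lambda$, let $\omega_0=0$, $\omega_1=\frac12$, $\omega_2=\frac{1+\tau}2$, $\omega_3=\frac\tau2$, and put $\wp_k=\wp(\omega_k)$ for $k=1,2,3$. Let $$\theta_1(u)=-\imath\sum_{k\in\mathbb Z}(-1)^k e^{\pi\imath\tau(k+\frac12)^2}e^{\pi\imath(2k+1)u},\qquad \theta_2(u)=\sum_{k\in\mathbb Z}e^{\pi\imath\tau(k+\frac12)^2}e^{\pi\imath(2k+1)u},$$ $$\theta_3(u)=\sum_{k\in\mathbb Z}e^{\pi\imath\tau k^2}e^{2\pi\imath ku},\qquad \theta_4(u)=\sum_{k\in\mathbb Z}(-1)^k e^{\pi\imath\tau k^2}e^{2\pi\imath ku}$$ be the Jacobi theta functions, and put $$\phi(z,u)=\frac{\theta_1'(0)\,\theta_1(z+u)}{\theta_1(z)\,\theta_1(u)},\qquad \varphi_a(z,x+\omega_a)=e^{2\pi\imath z\,\partial_\tau\omega_a}\,\phi(z,x+\omega_a)\quad(a=0,1,2,3),\qquad \varphi_k(z)=\varphi_k(z,\omega_k)\quad(k=1,2,3),$$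 $$c_1=-\Big(\frac{\theta_2(0)}{\theta_1'(0)}\Big)^2,\qquad c_2=-\imath\Big(\frac{\theta_3(0)}{\theta_1'(0)}\Big)^2,\qquad c_3=-\Big(\frac{\theta_4(0)}{\theta_1'(0)}\Big)^2 .$$ Let $\nu_0,\nu_1,\nu_2,\nu_3,\eta,c\in\mathbb C$ with $c\neq0$ and $2\eta\notin\Lambda$. Define the dual constants by $$\breve\nu_0=\tfrac12(\nu_0+\nu_1+\nu_2+\nu_3),\quad \breve\nu_1=\tfrac12(\nu_0+\nu_1-\nu_2-\nu_3),\quad \breve\nu_2=\tfrac12(\nu_0-\nu_1+\nu_2-\nu_3),\quad \breve\nu_3=\tfrac12(\nu_0-\nu_1-\nu_2+\nu_3),$$ and put $\breve v(q,\eta)=\sum_{a=0}^3\breve\nu_a\,\varphi_a(2q,\eta+\omega_a)$. For $p,q\in\mathbb C$ with $2q\notin\Lambda$ define $$S_0(p,q)=\frac12\Big(\breve v(q,\eta)e^{p/2c}+\breve v(-q,\eta)e^{-p/2c}\Big),$$ $$S_\alpha(p,q)=\frac{c_\alpha}2\Big(\breve v(q,\eta)e^{p/2c}-\breve v(-q,\eta)e^{-p/2c}\Big)\varphi_\alpha(2q)+c_\alpha\breve\nu_0\,\varphi_\beta(2q)\varphi_\gamma(2q)+c_\alpha\varphi_\alpha(2q)\sum_{k=1}^3\breve\nu_k\varphi_k(2q),$$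 where $\{\alpha,\beta,\gamma\}=\{1,2,3\}$, and let $\lambda_\alpha=\breve\nu_\alpha/c_\alpha$ for $\alpha=1,2,3$. Then the $S_a$ are holomorphic in $(p,q)$, and the map $(p,q)\mapsto(S_0,S_1,S_2,S_3)$ is Poisson from the canonical bracket $\{F,G\}=\partial_pF\,\partial_qG-\partial_qF\,\partial_pG$ (so $\{p,q\}=1$) to the classical $\mathrm{BC}_1$ Sklyanin algebra; that is, for all pairwise distinct $\alpha,\beta,\gamma\in\{1,2,3\}$ (no summation over repeated indices, $\varepsilon_{123}=1$) $$c\{S_\alpha,S_\beta\}=-\imath\varepsilon_{\alpha\beta\gamma}S_0S_\gamma,$$ $$c\{S_0,S_\alpha\}=-\imath\varepsilon_{\alpha\beta\gamma}S_\beta S_\gamma(\wp_\beta-\wp_\gamma)+\imath\varepsilon_{\alpha\beta\gamma}(S_\beta\lambda_\gamma-\lambda_\beta S_\gamma).$$ Moreover, the Casimir functions $C_1=S_1^2+S_2^2+S_3^2$ and $C_2=S_0^2+\sum_{k=1}^3\big(S_k^2\wp_k+2S_k\lambda_k\big)$ of this algebra take the constant values $$C_1=\breve\nu_0^2,\qquad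 C_2=\sum_{a=0}^3\breve\nu_a^2\,\wp(\eta+\omega_a)-\sum_{\alpha=1}^3\breve\nu_\alpha^2\,\wp(\omega_\alpha).$$ -/

import Mathlib

open Complex
open scoped UpperHalfPlane

noncomputable section

namespace BC1

/-! ### Theta functions -/

/-- `θ₁(u|τ) = ϑ(u)`. -/
def theta1 (τ : ℍ) (u : ℂ) : ℂ :=
  -I * ∑' k : ℤ, (-1 : ℂ) ^ k * exp (Real.pi * I * τ * ((k : ℂ) + 1 / 2) ^ 2) *
    exp (Real.pi * I * (2 * k + 1) * u)

/-- `θ₂(u|τ)`. -/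
def theta2 (τ : ℍ) (u : ℂ) : ℂ :=
  ∑' k : ℤ, exp (Real.pi * I * τ * ((k : ℂ) + 1 / 2) ^ 2) * exp (Real.pi * I * (2 * k + 1) * u)

/-- `θ₃(u|τ)`. -/
def theta3 (τ : ℍ) (u : ℂ) : ℂ :=
  ∑' k : ℤ, exp (Real.pi * I * τ * (k : ℂ) ^ 2) * exp (2 * Real.pi * I * k * u)

/-- `θ₄(u|τ)`. -/
def theta4 (τ : ℍ) (u : ℂ) : ℂ :=
  ∑' k : ℤ, (-1 : ℂ) ^ k * exp (Real.pi * I * τ * (k : ℂ) ^ 2) * exp (2 * Real.pi * I * k * u)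

/-- `ϑ'(0)`. -/
def theta1Deriv0 (τ : ℍ) : ℂ := deriv (theta1 τ) 0

/-! ### The period lattice, half-periods, and elliptic functions -/

theorem linearIndependent_one_tau (τ : ℍ) : LinearIndependent ℝ ![(1 : ℂ), (τ : ℂ)] := by
  rw [LinearIndependent.pair_iff]
  intro s t h
  have him := congrArg Complex.im h
  have hre := congrArg Complex.re h
  have ht : t = 0 := by
    have hpos := τ.im_pos
    have h0 : t * τ.im = 0 := by simpa using him
    rcases mul_eq_zero.mp h0 with h1 | h1
    · exact h1
    · exact absurd h1 hpos.ne'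
  subst ht
  exact ⟨by simpa using hre, rfl⟩

/-- The pair of periods `1, τ`; its lattice is `ℤ + τℤ`. -/
def periods (τ : ℍ) : PeriodPair := ⟨1, τ, linearIndependent_one_tau τ⟩

/-- The Weierstrass function `℘` of the lattice `ℤ + τℤ`. -/
def wp (τ : ℍ) (z : ℂ) : ℂ := (periods τ).weierstrassP z

/-- The half-periods `ω₀ = 0, ω₁ = 1/2, ω₂ = (1+τ)/2, ω₃ = τ/2`. -/
def halfPeriod (τ : ℍ) : Fin 4 → ℂ := ![0, 1 / 2, (1 + τ) / 2, τ / 2]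

/-- The derivatives `∂ω_a/∂τ`. -/
def dHalfPeriod : Fin 4 → ℂ := ![0, 0, 1 / 2, 1 / 2]

/-- The elliptic Kronecker function `φ(z,u) = ϑ'(0) ϑ(z+u) / (ϑ(z) ϑ(u))`. -/
def kronecker (τ : ℍ) (z u : ℂ) : ℂ :=
  theta1Deriv0 τ * theta1 τ (z + u) / (theta1 τ z * theta1 τ u)

/-- `varphi τ a z x` is `φ_a(z, x + ω_a) = exp(2πi z ∂_τ ω_a) φ(z, x + ω_a)`. -/
def varphi (τ : ℍ) (a : Fin 4) (z x : ℂ) : ℂ :=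
  exp (2 * Real.pi * I * z * dHalfPeriod a) * kronecker τ z (x + halfPeriod τ a)

/-- `varphi₀ τ a z` is `φ_a(z) = φ_a(z, ω_a)`, used for `a = 1, 2, 3`. -/
def varphi₀ (τ : ℍ) (a : Fin 4) (z : ℂ) : ℂ := varphi τ a z 0

/-- The theta-constants `c₁, c₂, c₃`; the entry with index `0` is not used. -/
def cConst (τ : ℍ) : Fin 4 → ℂ :=
  ![0, -(theta2 τ 0 / theta1Deriv0 τ) ^ 2, -I * (theta3 τ 0 / theta1Deriv0 τ) ^ 2,
    -(theta4 τ 0 / theta1Deriv0 τ) ^ 2]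

/-! ### The change of variables -/

/-- `v(z,u|ν) = ∑ₐ νₐ φₐ(2z, u + ωₐ)`. -/
def v (τ : ℍ) (ν : Fin 4 → ℂ) (z u : ℂ) : ℂ := ∑ a, ν a * varphi τ a (2 * z) u

/-- The dual constants `ν̆`. -/
def dual (ν : Fin 4 → ℂ) : Fin 4 → ℂ :=
  (1 / 2 : ℂ) • (!![1, 1, 1, 1; 1, 1, -1, -1; 1, -1, 1, -1; 1, -1, -1, 1] : Matrix _ _ ℂ).mulVec ν

/-- `v̆(u,z) = v(u,z|ν̆)`. -/
def vDual (τ : ℍ) (ν : Fin 4 → ℂ) (u z : ℂ) : ℂ := v τ (dual ν) u z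

/-- The functions `S_a(p,q)`, `a = 0, 1, 2, 3`. For `a = α ≠ 0` the product over the indices
different from `0` and `α` is `φ_β(2q) φ_γ(2q)`. -/
def S (τ : ℍ) (c η : ℂ) (ν : Fin 4 → ℂ) (a : Fin 4) (p q : ℂ) : ℂ :=
  if a = 0 then
    1 / 2 * (vDual τ ν q η * exp (p / (2 * c)) + vDual τ ν (-q) η * exp (-p / (2 * c)))
  else
    cConst τ a / 2 * (vDual τ ν q η * exp (p / (2 * c)) - vDual τ ν (-q) η * exp (-p / (2 * c))) *
        varphi₀ τ a (2 * q) +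
      cConst τ a * dual ν 0 * (∏ b ∈ ({1, 2, 3} : Finset (Fin 4)).erase a, varphi₀ τ b (2 * q)) +
      cConst τ a * varphi₀ τ a (2 * q) *
        ∑ k ∈ ({1, 2, 3} : Finset (Fin 4)), dual ν k * varphi₀ τ k (2 * q)

/-- `λ_α = ν̆_α / c_α` for `α = 1, 2, 3`; the entry with index `0` is not used. -/
def lam (τ : ℍ) (ν : Fin 4 → ℂ) (α : Fin 4) : ℂ := dual ν α / cConst τ α

/-! ### Brackets and Casimir functions -/

/-- The canonical Poisson bracket, normalized by `{p,q} = 1`. -/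
def canonicalBracket (F G : ℂ → ℂ → ℂ) (p q : ℂ) : ℂ :=
  deriv (fun x => F x q) p * deriv (fun y => G p y) q -
    deriv (fun y => F p y) q * deriv (fun x => G x q) p

/-- The Levi-Civita symbol on the indices `1, 2, 3`. -/
def eps (α β γ : Fin 4) : ℂ :=
  if (α, β, γ) ∈ ({(1, 2, 3), (2, 3, 1), (3, 1, 2)} : Finset (Fin 4 × Fin 4 × Fin 4)) then 1
  else if (α, β, γ) ∈ ({(1, 3, 2), (3, 2, 1), (2, 1, 3)} : Finset (Fin 4 × Fin 4 × Fin 4)) then -1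
  else 0

/-- `C₁ = S₁² + S₂² + S₃²`. -/
def casimir1 (s : Fin 4 → ℂ) : ℂ := ∑ k ∈ ({1, 2, 3} : Finset (Fin 4)), s k ^ 2

/-- `C₂ = S₀² + ∑_{k=1}^3 (S_k² ℘(ω_k) + 2 S_k λ_k)`. -/
def casimir2 (τ : ℍ) (l : Fin 4 → ℂ) (s : Fin 4 → ℂ) : ℂ :=
  s 0 ^ 2 + ∑ k ∈ ({1, 2, 3} : Finset (Fin 4)), (s k ^ 2 * wp τ (halfPeriod τ k) + 2 * s k * l k)

end BC1

end

/-!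
The identities between elliptic functions behind the statement all come from one addition formula,
which is derived from the theta series alone, without product expansions.

An entire function with the translation laws of `θ₁²` is determined by two consecutive Fourier
coefficients, so such functions form a space of dimension at most two
(`IsOrderTwo.exists_relation`). It contains `θ₁²`, the entire extension of `θ₁² ℘`, and
`θ₁(z + b) θ₁(z - b)` for each `b`. The first two are independent because `℘` has a pole, and
comparing coefficients gives
`θ₁'(0)² θ₁(a + b) θ₁(a - b) = -θ₁(a)² θ₁(b)² (℘(a) - ℘(b))` (`theta1_addition`). This formula
shows that `θ₁'(0) ≠ 0` and that `θ₁` vanishes only on the lattice, and it implies the three-term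
identity (`theta1_three_term`) and the duplication formula for `℘'` (`deriv_wp_mul`).

In terms of the functions `φ_a` one obtains `φ_a(z, u) φ_a(-z, u) = ℘(u + ω_a) - ℘(z)`,
`φ_k² = ℘ - ℘(ω_k)`, `φ_α' = -φ_β φ_γ`, and for `a ≠ b` that
`φ_a(z, u) φ_b(-z, u) + φ_b(z, u) φ_a(-z, u)` does not depend on `u`: it is `-2 φ_β(z) φ_γ(z)` for
`{a, b} = {0, α}` and `-2 φ_α(z) φ_β(z)` for `{a, b} = {α, β}`. Hence the product
`v̆(q, η) v̆(-q, η)` is an explicit polynomial in the `φ_k(2q)` (`v_mul_v_neg`). The theta-constants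
satisfy `c_α c_β (℘(ω_α) - ℘(ω_β)) = -i ε_{αβγ} c_γ` (`cConst_mul`); consequently the `c_k²` are
the Lagrange weights of the nodes `℘(ω_k)`.

The rest is algebra. Write `W = v̆(q, η) e^{p/2c} - v̆(-q, η) e^{-p/2c}` and
`X = W / 2 + ∑ ν̆_k φ_k(2q)`, so that `S_α / c_α = φ_α X + ν̆₀ φ_β φ_γ` and
`S₀² = W² / 4 + v̆(q, η) v̆(-q, η)`. In `{S_α, S_β}` the derivatives of `v̆` cancel, and in
`{S₀, S_α}` they enter only through the derivative of `v̆(q, η) v̆(-q, η)`. The values of the Casimir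
functions follow from the identities `∑ c_k² = ∑ c_k² ℘(ω_k) = 0`, `∑ c_k² ℘(ω_k)² = 1`.
-/

namespace BC1

/-! ### The odd theta function -/

theorem exp_eq_neg_exp {x y : ℂ} (h : x = y + Real.pi * I) : exp x = -exp y := by
  rw [h, exp_add, exp_pi_mul_I, mul_neg_one]

theorem theta1_eq_jacobiTheta₂ (τ : ℍ) (u : ℂ) :
    theta1 τ u = -I * exp (Real.pi * I * τ / 4 + Real.pi * I * u) *
      jacobiTheta₂ (u + (1 + τ) / 2) τ := by
  rw [theta1, jacobiTheta₂, mul_assoc (-I)]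
  congr 1
  rw [← tsum_mul_left]
  refine tsum_congr fun k => ?_
  have h : (-1 : ℂ) ^ k = exp (k * (Real.pi * I)) := by rw [exp_int_mul, exp_pi_mul_I]
  rw [h, jacobiTheta₂_term, ← exp_add, ← exp_add, ← exp_add]
  congr 1
  ring

theorem theta2_zero (τ : ℍ) : theta2 τ 0 = theta1 τ (1 / 2) := by
  rw [theta1, theta2, ← tsum_mul_left]
  refine tsum_congr fun k => ?_
  have h : (-1 : ℂ) ^ k * exp (Real.pi * I * (2 * k + 1) * (1 / 2)) = I := by
    have h1 : exp (Real.pi * I * (2 * k + 1) * (1 / 2)) = (-1 : ℂ) ^ k * I := by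
      rw [show (Real.pi * I * (2 * k + 1) * (1 / 2) : ℂ) = k * (Real.pi * I) + Real.pi / 2 * I by
        ring, exp_add, exp_int_mul, exp_pi_mul_I, exp_pi_div_two_mul_I]
    rw [h1, ← mul_assoc, ← mul_zpow]
    simp
  rw [mul_right_comm ((-1 : ℂ) ^ k), h]
  simp only [mul_zero, exp_zero, mul_one]
  rw [← mul_assoc]
  simp

theorem theta3_zero (τ : ℍ) :
    theta3 τ 0 = exp (Real.pi * I * τ / 4) * theta1 τ ((1 + τ) / 2) := by
  have h1 : theta3 τ 0 = jacobiTheta₂ 0 τ := by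
    refine tsum_congr fun k => ?_
    rw [jacobiTheta₂_term, ← exp_add]
    congr 1
    ring
  have h2 : jacobiTheta₂ ((1 + τ) / 2 + (1 + τ) / 2) τ = exp (-Real.pi * I * τ) * theta3 τ 0 := by
    rw [h1, show ((1 + τ) / 2 + (1 + τ) / 2 : ℂ) = (0 + τ) + 1 by ring, jacobiTheta₂_add_left,
      jacobiTheta₂_add_left']
    congr 2
    ring
  rw [theta1_eq_jacobiTheta₂, h2]
  have h : exp (Real.pi * I * τ / 4) * exp (Real.pi * I * τ / 4 + Real.pi * I * ((1 + τ) / 2)) *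
      exp (-Real.pi * I * τ) = I := by
    rw [← exp_add, ← exp_add, show (Real.pi * I * τ / 4 + (Real.pi * I * τ / 4 +
      Real.pi * I * ((1 + τ) / 2)) + -Real.pi * I * τ : ℂ) = Real.pi / 2 * I by ring,
      exp_pi_div_two_mul_I]
  linear_combination theta3 τ 0 * I_mul_I + I * theta3 τ 0 * h

theorem theta4_zero (τ : ℍ) :
    theta4 τ 0 = -I * exp (Real.pi * I * τ / 4) * theta1 τ (τ / 2) := by
  have h1 : theta4 τ 0 = jacobiTheta₂ (1 / 2) τ := by
    refine tsum_congr fun k => ?_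
    have h : (-1 : ℂ) ^ k = exp (k * (Real.pi * I)) := by rw [exp_int_mul, exp_pi_mul_I]
    rw [h, jacobiTheta₂_term, ← exp_add, ← exp_add]
    congr 1
    ring
  have h2 : jacobiTheta₂ (τ / 2 + (1 + τ) / 2) τ = -exp (-Real.pi * I * τ) * theta4 τ 0 := by
    rw [h1, show (τ / 2 + (1 + τ) / 2 : ℂ) = 1 / 2 + τ by ring, jacobiTheta₂_add_left']
    congr 1
    rw [eq_comm, neg_eq_iff_eq_neg]
    refine exp_eq_neg_exp ?_
    ring
  rw [theta1_eq_jacobiTheta₂, h2]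
  have h : exp (Real.pi * I * τ / 4) * exp (Real.pi * I * τ / 4 + Real.pi * I * (τ / 2)) *
      exp (-Real.pi * I * τ) = 1 := by
    rw [← exp_zero, ← exp_add, ← exp_add]
    congr 1
    ring
  linear_combination (-theta4 τ 0) * h + theta4 τ 0 * exp (Real.pi * I * τ / 4) *
    exp (Real.pi * I * τ / 4 + Real.pi * I * (τ / 2)) * exp (-Real.pi * I * τ) * I_mul_I

theorem differentiable_theta1 (τ : ℍ) : Differentiable ℂ (theta1 τ) := by
  have h : theta1 τ = fun u => -I * exp (Real.pi * I * τ / 4 + Real.pi * I * u) *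
      jacobiTheta₂ (u + (1 + τ) / 2) τ := funext fun u => theta1_eq_jacobiTheta₂ τ u
  rw [h]
  intro u
  refine DifferentiableAt.mul (by fun_prop) ?_
  exact DifferentiableAt.comp u (f := fun u : ℂ => u + (1 + τ) / 2)
    (differentiableAt_jacobiTheta₂_fst (u + (1 + τ) / 2) τ.im_pos) (by fun_prop)

theorem theta1_add_one (τ : ℍ) (u : ℂ) : theta1 τ (u + 1) = -theta1 τ u := by
  rw [theta1_eq_jacobiTheta₂, theta1_eq_jacobiTheta₂,
    show u + 1 + (1 + τ) / 2 = (u + (1 + τ) / 2) + 1 by ring, jacobiTheta₂_add_left,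
    show Real.pi * I * τ / 4 + Real.pi * I * (u + 1) =
      (Real.pi * I * τ / 4 + Real.pi * I * u) + Real.pi * I by ring, exp_add _ (Real.pi * I),
    exp_pi_mul_I]
  ring

theorem theta1_add_tau (τ : ℍ) (u : ℂ) :
    theta1 τ (u + τ) = -exp (-Real.pi * I * τ - 2 * Real.pi * I * u) * theta1 τ u := by
  rw [theta1_eq_jacobiTheta₂, theta1_eq_jacobiTheta₂,
    show u + τ + (1 + τ) / 2 = (u + (1 + τ) / 2) + τ by ring, jacobiTheta₂_add_left']
  have h : exp (Real.pi * I * τ / 4 + Real.pi * I * (u + τ)) *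
      exp (-Real.pi * I * (τ + 2 * (u + (1 + τ) / 2))) =
      -exp (-Real.pi * I * τ - 2 * Real.pi * I * u) *
        exp (Real.pi * I * τ / 4 + Real.pi * I * u) := by
    rw [neg_mul (exp _), ← exp_add, ← exp_add, eq_comm, neg_eq_iff_eq_neg]
    refine exp_eq_neg_exp ?_
    ring
  linear_combination (-I * jacobiTheta₂ (u + (1 + τ) / 2) τ) * h

theorem theta1_neg (τ : ℍ) (u : ℂ) : theta1 τ (-u) = -theta1 τ u := by
  rw [theta1_eq_jacobiTheta₂, theta1_eq_jacobiTheta₂, ← jacobiTheta₂_neg_left (u + _),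
    show -u + (1 + τ) / 2 = ((-(u + (1 + τ) / 2)) + τ) + 1 by ring, jacobiTheta₂_add_left,
    jacobiTheta₂_add_left']
  have h : exp (Real.pi * I * τ / 4 + Real.pi * I * -u) *
      exp (-Real.pi * I * (τ + 2 * (-(u + (1 + τ) / 2)))) =
      -exp (Real.pi * I * τ / 4 + Real.pi * I * u) := by
    rw [← exp_add]
    refine exp_eq_neg_exp ?_
    ring
  linear_combination (-I * jacobiTheta₂ (-(u + (1 + τ) / 2)) τ) * h

theorem theta1_zero (τ : ℍ) : theta1 τ 0 = 0 := by
  have h := theta1_neg τ 0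
  rw [neg_zero] at h
  linear_combination h / 2

/-- The mean of `jacobiTheta₂` over the real period is its zeroth Fourier coefficient `1`. -/
theorem integral_jacobiTheta₂ {τ : ℂ} (hτ : 0 < τ.im) :
    ∫ x in (0 : ℝ)..1, jacobiTheta₂ x τ = 1 := by
  let f : ℤ → C(ℝ, ℂ) := fun n => ⟨fun x => jacobiTheta₂_term n x τ, by
    unfold jacobiTheta₂_term; fun_prop⟩
  have hsum : Summable fun n : ℤ =>
      ‖(f n).restrict (⟨Set.uIcc (0 : ℝ) 1, isCompact_uIcc⟩ : TopologicalSpace.Compacts ℝ)‖ := by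
    refine Summable.of_nonneg_of_le (fun _ => norm_nonneg _) (fun n => ?_)
      ((summable_jacobiTheta₂_term_iff 0 τ).2 hτ).norm
    refine (ContinuousMap.norm_le _ (norm_nonneg _)).2 fun x => ?_
    simp [f, norm_jacobiTheta₂_term]
  have h := intervalIntegral.tsum_intervalIntegral_eq_of_summable_norm hsum
  have hint : ∀ n : ℤ, ∫ x in (0 : ℝ)..1, f n x = if n = 0 then 1 else 0 := by
    intro n
    by_cases hn : n = 0
    · subst hn
      simp [f, jacobiTheta₂_term]
    · have hc : (2 * Real.pi * I * n : ℂ) ≠ 0 := by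
        simp [Real.pi_ne_zero, hn]
      have : ∀ x : ℝ, f n x = exp (Real.pi * I * n ^ 2 * τ) * exp (2 * Real.pi * I * n * x) := by
        intro x
        simp only [f, ContinuousMap.coe_mk, jacobiTheta₂_term]
        rw [← exp_add, add_comm]
      simp_rw [this]
      rw [intervalIntegral.integral_const_mul, integral_exp_mul_complex hc]
      have h1 : exp (2 * Real.pi * I * n) = 1 := by
        rw [mul_comm, exp_int_mul_two_pi_mul_I]
      simp [h1, hn]
  simp_rw [hint] at h
  rw [tsum_ite_eq] at h
  rw [h]
  rfl

theorem exists_theta1_ne_zero (τ : ℍ) : ∃ z, theta1 τ z ≠ 0 := by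
  by_contra! h
  have h0 : ∀ z, jacobiTheta₂ z τ = 0 := by
    intro z
    have h1 := h (z - (1 + τ) / 2)
    rw [theta1_eq_jacobiTheta₂, sub_add_cancel] at h1
    simpa [exp_ne_zero] using h1
  have h2 := integral_jacobiTheta₂ τ.im_pos
  simp [h0] at h2

/-! ### Entire functions with a multiplier -/

/-- The `n`-th Fourier coefficient of (the restriction to the real line of) a `1`-periodic
function on the complex plane. -/
noncomputable def lineCoeff (g : ℂ → ℂ) (n : ℤ) : ℂ :=
  ∫ x in (0 : ℝ)..1, g x * exp (-(2 * Real.pi * I * n * x))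

/-- By Cauchy's theorem for a rectangle and periodicity, the mean of an entire `1`-periodic
function over a period does not depend on the horizontal line, nor on the starting point. -/
theorem integral_add_const_of_periodic {h : ℂ → ℂ} (hd : Differentiable ℂ h)
    (hp : ∀ z, h (z + 1) = h z) (w : ℂ) :
    ∫ x in (0 : ℝ)..1, h (x + w) = ∫ x in (0 : ℝ)..1, h x := by
  have h1 := integral_boundary_rect_eq_zero_of_differentiableOn h 0 (1 + w.im * I)
    hd.differentiableOn
  have h2 : ∀ y : ℝ, h (1 + y * I) = h (y * I) := fun y => by rw [add_comm, hp]
  simp only [zero_re, zero_im, add_re, one_re, mul_re, ofReal_re, I_re, mul_zero, ofReal_im, I_im,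
    mul_one, sub_self, add_zero, add_im, one_im, mul_im, zero_add, ofReal_zero, zero_mul,
    ofReal_one, h2] at h1
  have h3 : ∫ x in (0 : ℝ)..1, h (x + w) = ∫ x in (0 : ℝ)..1, h (x + w.im * I) := by
    have hper : Function.Periodic (fun x : ℝ => h (x + w.im * I)) 1 := by
      intro x
      simp only [ofReal_add, ofReal_one]
      rw [show (x + 1 + w.im * I : ℂ) = x + w.im * I + 1 by ring, hp]
    have h4 := hper.intervalIntegral_add_eq w.re 0
    rw [zero_add] at h4
    rw [← h4]
    have h5 := intervalIntegral.integral_comp_add_right (a := 0) (b := 1)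
      (fun x : ℝ => h (x + w.im * I)) w.re
    rw [zero_add, add_comm 1 w.re] at h5
    rw [← h5]
    congr 1
    ext x
    congr 1
    push_cast
    rw [add_assoc, re_add_im]
  rw [h3]
  linear_combination -h1

/-- An entire `1`-periodic function whose Fourier coefficients vanish is zero. -/
theorem eq_zero_of_lineCoeff_eq_zero {g : ℂ → ℂ} (hd : Differentiable ℂ g)
    (hp : ∀ z, g (z + 1) = g z) (h0 : ∀ n, lineCoeff g n = 0) : g = 0 := by
  have hper : Function.Periodic (fun x : ℝ => g x) 1 := by
    intro x
    simp [hp]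
  have hcont : Continuous (fun x : ℝ => g x) := hd.continuous.comp continuous_ofReal
  let F : C(AddCircle (1 : ℝ), ℂ) := ⟨hper.lift, continuous_coinduced_dom.mpr hcont⟩
  have hF : fourierCoeff F = 0 := by
    ext n
    have hint : ∀ x : ℝ, fourier (-n) (x : AddCircle (1 : ℝ)) • F x =
        g x * exp (-(2 * Real.pi * I * n * x)) := by
      intro x
      rw [fourier_coe_apply, smul_eq_mul, mul_comm, show F x = g x from rfl]
      congr 2
      push_cast
      ring
    rw [fourierCoeff_eq_intervalIntegral F n 0, zero_add]
    simp_rw [hint]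
    exact (congrArg _ (h0 n)).trans (smul_zero _)
  have hs := has_pointwise_sum_fourier_series_of_summable (f := F) (by rw [hF]; exact summable_zero)
  have hreal : ∀ x : ℝ, g x = 0 := by
    intro x
    have h1 := hs x
    simp only [hF, Pi.zero_apply, zero_smul] at h1
    exact (h1.unique hasSum_zero)
  have han : AnalyticOnNhd ℂ g Set.univ := fun z _ => hd.analyticAt z
  have hfreq : ∃ᶠ z in nhdsWithin (0 : ℂ) {0}ᶜ, g z = 0 := by
    have h1 : Filter.Tendsto (fun x : ℝ => (x : ℂ)) (nhdsWithin 0 {0}ᶜ)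
        (nhdsWithin (0 : ℂ) {0}ᶜ) := by
      refine tendsto_nhdsWithin_iff.2 ⟨?_, ?_⟩
      · exact (continuous_ofReal.tendsto' 0 0 ofReal_zero).mono_left nhdsWithin_le_nhds
      · filter_upwards [self_mem_nhdsWithin] with x hx
        simpa using hx
    exact h1.frequently (Filter.Frequently.of_forall hreal)
  funext z
  exact han.eqOn_zero_of_preconnected_of_frequently_eq_zero isPreconnected_univ
    (Set.mem_univ 0) hfreq (Set.mem_univ z)

/-- The translation law of `g` under `τ` links its `n`-th and `(n + N)`-th Fourier
coefficients. -/
theorem lineCoeff_eq_mul_lineCoeff_add {τ μ : ℂ} {N : ℤ} {g : ℂ → ℂ} (hd : Differentiable ℂ g)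
    (hp : ∀ z, g (z + 1) = g z)
    (hq : ∀ z, g (z + τ) = μ * exp (-(2 * Real.pi * I * N * z)) * g z) (n : ℤ) :
    lineCoeff g n = μ * exp (-(2 * Real.pi * I * n * τ)) * lineCoeff g (n + N) := by
  have h := integral_add_const_of_periodic
    (h := fun z => g z * exp (-(2 * Real.pi * I * n * z))) (by fun_prop) (fun z => by
      have h1 : exp (-(2 * Real.pi * I * n * (z + 1))) = exp (-(2 * Real.pi * I * n * z)) := by
        rw [show -(2 * Real.pi * I * n * (z + 1)) =
          -(2 * Real.pi * I * n * z) + ((-n : ℤ) : ℂ) * (2 * Real.pi * I) by push_cast; ring,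
          exp_add, exp_int_mul_two_pi_mul_I, mul_one]
      simp only [hp, h1]) τ
  rw [lineCoeff, ← h, lineCoeff, ← intervalIntegral.integral_const_mul]
  congr 1
  ext x
  rw [hq]
  have h2 : exp (-(2 * Real.pi * I * N * x)) * exp (-(2 * Real.pi * I * n * (x + τ))) =
      exp (-(2 * Real.pi * I * n * τ)) * exp (-(2 * Real.pi * I * (n + N : ℤ) * x)) := by
    rw [← exp_add, ← exp_add]
    congr 1
    push_cast
    ring
  linear_combination μ * g x * h2

/-- An entire function with the translation laws of a theta function of order two is determined
by two consecutive Fourier coefficients. -/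
theorem eq_zero_of_lineCoeff_zero_one {τ μ : ℂ} (hμ : μ ≠ 0) {g : ℂ → ℂ}
    (hd : Differentiable ℂ g) (hp : ∀ z, g (z + 1) = g z)
    (hq : ∀ z, g (z + τ) = μ * exp (-(4 * Real.pi * I * z)) * g z)
    (h0 : lineCoeff g 0 = 0) (h1 : lineCoeff g 1 = 0) : g = 0 := by
  have key := lineCoeff_eq_mul_lineCoeff_add (τ := τ) (μ := μ) (N := 2) hd hp (fun z => by
    rw [hq]; congr 3; push_cast; ring)
  have hiff : ∀ n, lineCoeff g n = 0 ↔ lineCoeff g (n + 2) = 0 := by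
    intro n
    rw [key n]
    simp [hμ, exp_ne_zero]
  refine eq_zero_of_lineCoeff_eq_zero hd hp fun n => ?_
  have hpair : ∀ n : ℤ, lineCoeff g n = 0 ∧ lineCoeff g (n + 1) = 0 := by
    intro n
    induction n using Int.induction_on with
    | zero => exact ⟨h0, by simpa using h1⟩
    | succ k ih => exact ⟨ih.2, by rw [add_assoc]; exact (hiff _).1 ih.1⟩
    | pred k ih =>
      refine ⟨(hiff _).2 ?_, by simpa using ih.1⟩
      rw [show -(k : ℤ) - 1 + 2 = -(k : ℤ) + 1 by ring]
      exact ih.2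
  exact (hpair n).1

/-- The translation laws of a theta function of order two: entire, of period `1`, and multiplied
by `exp (-2πi (τ + 2z))` under `z ↦ z + τ`. These are the laws of `theta1 τ ^ 2`. -/
structure IsOrderTwo (τ : ℂ) (g : ℂ → ℂ) : Prop where
  differentiable : Differentiable ℂ g
  add_one : ∀ z, g (z + 1) = g z
  add_tau : ∀ z, g (z + τ) = exp (-(2 * Real.pi * I * τ)) * exp (-(4 * Real.pi * I * z)) * g z

theorem lineCoeff_sum {ι : Type*} (s : Finset ι) (c : ι → ℂ) (g : ι → ℂ → ℂ)
    (hg : ∀ i, Differentiable ℂ (g i)) (n : ℤ) :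
    lineCoeff (fun z => ∑ i ∈ s, c i * g i z) n = ∑ i ∈ s, c i * lineCoeff (g i) n := by
  simp only [lineCoeff, Finset.sum_mul]
  rw [intervalIntegral.integral_finsetSum]
  · refine Finset.sum_congr rfl fun i _ => ?_
    rw [← intervalIntegral.integral_const_mul]
    congr 1
    ext x
    ring
  · intro i _
    have := (hg i).continuous
    exact Continuous.intervalIntegrable (by fun_prop) _ _

/-- Theta functions of order two form a space of dimension at most two. -/
theorem IsOrderTwo.exists_relation {τ : ℂ} (g : Fin 3 → ℂ → ℂ) (hg : ∀ i, IsOrderTwo τ (g i)) :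
    ∃ c : Fin 3 → ℂ, c ≠ 0 ∧ ∀ z, ∑ i, c i * g i z = 0 := by
  let A : Matrix (Fin 2) (Fin 3) ℂ := fun k i => lineCoeff (g i) (k : ℕ)
  have hker : LinearMap.ker A.mulVecLin ≠ ⊥ := LinearMap.ker_ne_bot_of_finrank_lt (by simp)
  obtain ⟨c, hc, hc0⟩ := Submodule.exists_mem_ne_zero_of_ne_bot hker
  refine ⟨c, hc0, ?_⟩
  have hA : A.mulVec c = 0 := hc
  have hA' : ∀ k : Fin 2, lineCoeff (fun z => ∑ i, c i * g i z) (k : ℕ) = 0 := by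
    intro k
    rw [lineCoeff_sum _ _ _ fun i => (hg i).differentiable]
    have := congrFun hA k
    simp only [Matrix.mulVec, dotProduct, Pi.zero_apply] at this
    rw [← this]
    exact Finset.sum_congr rfl fun i _ => mul_comm _ _
  have h := eq_zero_of_lineCoeff_zero_one (τ := τ) (μ := exp (-(2 * Real.pi * I * τ)))
    (exp_ne_zero _) (g := fun z => ∑ i, c i * g i z)
    (by have := fun i => (hg i).differentiable; fun_prop)
    (fun z => Finset.sum_congr rfl fun i _ => by rw [(hg i).add_one])
    (fun z => by
      rw [Finset.mul_sum]
      exact Finset.sum_congr rfl fun i _ => by rw [(hg i).add_tau]; ring)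
    (by simpa using hA' 0) (by simpa using hA' 1)
  exact fun z => congrFun h z

/-! ### The period lattice -/

theorem one_mem_lattice (τ : ℍ) : (1 : ℂ) ∈ (periods τ).lattice := (periods τ).ω₁_mem_lattice

theorem tau_mem_lattice (τ : ℍ) : (τ : ℂ) ∈ (periods τ).lattice := (periods τ).ω₂_mem_lattice

theorem lattice_induction {τ : ℍ} {P : ℂ → Prop} (h1 : P 1) (hτ : P τ) (h0 : P 0)
    (hadd : ∀ x y, P x → P y → P (x + y)) (hneg : ∀ x, P x → P (-x)) {l : ℂ}
    (hl : l ∈ (periods τ).lattice) : P l := by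
  rw [PeriodPair.lattice, ← Submodule.mem_toAddSubgroup,
    Submodule.span_int_eq_addSubgroupClosure] at hl
  induction hl using AddSubgroup.closure_induction with
  | mem x hx =>
    rcases hx with rfl | hx
    · exact h1
    · rw [Set.mem_singleton_iff.1 hx]; exact hτ
  | zero => exact h0
  | add x y _ _ hx hy => exact hadd x y hx hy
  | neg x _ hx => exact hneg x hx

theorem countable_lattice (τ : ℍ) : ((periods τ).lattice : Set ℂ).Countable := by
  have h : ((periods τ).lattice : Set ℂ) ⊆
      Set.range fun x : ℤ × ℤ => (x.1 * (periods τ).ω₁ + x.2 * (periods τ).ω₂ : ℂ) := by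
    intro z hz
    obtain ⟨m, n, h⟩ := PeriodPair.mem_lattice.1 hz
    exact ⟨(m, n), h⟩
  exact (Set.countable_range _).mono h

theorem isPreconnected_compl_lattice (τ : ℍ) :
    IsPreconnected (((periods τ).lattice : Set ℂ)ᶜ) :=
  ((countable_lattice τ).isPathConnected_compl_of_one_lt_rank
    (by rw [Complex.rank_real_complex]; norm_num)).isConnected.isPreconnected

theorem isOpen_compl_lattice (τ : ℍ) : IsOpen (((periods τ).lattice : Set ℂ)ᶜ) :=
  (periods τ).isClosed_lattice.isOpen_compl

theorem wp_add {τ : ℍ} (z : ℂ) {l : ℂ} (hl : l ∈ (periods τ).lattice) :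
    wp τ (z + l) = wp τ z := (periods τ).weierstrassP_add_coe z ⟨l, hl⟩

theorem differentiableOn_wp (τ : ℍ) :
    DifferentiableOn ℂ (wp τ) (((periods τ).lattice : Set ℂ)ᶜ) :=
  (periods τ).differentiableOn_weierstrassP

theorem differentiableAt_wp {τ : ℍ} {z : ℂ} (hz : z ∉ (periods τ).lattice) :
    DifferentiableAt ℂ (wp τ) z :=
  (differentiableOn_wp τ).differentiableAt ((isOpen_compl_lattice τ).mem_nhds hz)

theorem theta1_add_eq_zero_iff {τ : ℍ} (z : ℂ) {l : ℂ} (hl : l ∈ (periods τ).lattice) :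
    theta1 τ (z + l) = 0 ↔ theta1 τ z = 0 := by
  revert z
  refine lattice_induction (P := fun l => ∀ z, theta1 τ (z + l) = 0 ↔ theta1 τ z = 0)
    ?_ ?_ ?_ ?_ ?_ hl
  · intro z
    rw [theta1_add_one, neg_eq_zero]
  · intro z
    rw [theta1_add_tau]
    simp [exp_ne_zero]
  · simp
  · intro x y hx hy z
    rw [← add_assoc, hy, hx]
  · intro x hx z
    rw [← hx (z + -x), neg_add_cancel_right]

theorem theta1_eq_zero_of_mem {τ : ℍ} {l : ℂ} (hl : l ∈ (periods τ).lattice) :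
    theta1 τ l = 0 := by
  rw [← zero_add l, theta1_add_eq_zero_iff 0 hl, theta1_zero]

/-! ### The addition formula and the zeros of theta -/

theorem isOrderTwo_theta1_mul (τ : ℍ) (b : ℂ) :
    IsOrderTwo τ fun z => theta1 τ (z + b) * theta1 τ (z - b) where
  differentiable := by
    have := differentiable_theta1 τ
    fun_prop
  add_one z := by
    rw [show z + 1 + b = z + b + 1 by ring, show z + 1 - b = z - b + 1 by ring, theta1_add_one,
      theta1_add_one]
    ring
  add_tau z := by
    rw [show z + τ + b = z + b + τ by ring, show z + τ - b = z - b + τ by ring, theta1_add_tau,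
      theta1_add_tau]
    have h : exp (-Real.pi * I * τ - 2 * Real.pi * I * (z + b)) *
        exp (-Real.pi * I * τ - 2 * Real.pi * I * (z - b)) =
        exp (-(2 * Real.pi * I * τ)) * exp (-(4 * Real.pi * I * z)) := by
      rw [← exp_add, ← exp_add]
      congr 1
      ring
    linear_combination theta1 τ (z + b) * theta1 τ (z - b) * h

open Classical in
/-- The entire function `θ₁² ℘`; at a lattice point, where `℘` has a double pole and `θ₁` a zero,
its value is the limit `θ₁'²`. -/
noncomputable def thetaSqWp (τ : ℍ) (z : ℂ) : ℂ :=
  if z ∈ (periods τ).lattice then deriv (theta1 τ) z ^ 2 else theta1 τ z ^ 2 * wp τ z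

theorem thetaSqWp_of_mem {τ : ℍ} {z : ℂ} (hz : z ∈ (periods τ).lattice) :
    thetaSqWp τ z = deriv (theta1 τ) z ^ 2 := if_pos hz

theorem thetaSqWp_of_notMem {τ : ℍ} {z : ℂ} (hz : z ∉ (periods τ).lattice) :
    thetaSqWp τ z = theta1 τ z ^ 2 * wp τ z := if_neg hz

theorem thetaSqWp_zero (τ : ℍ) : thetaSqWp τ 0 = theta1Deriv0 τ ^ 2 :=
  thetaSqWp_of_mem (zero_mem _)

theorem differentiable_thetaSqWp (τ : ℍ) : Differentiable ℂ (thetaSqWp τ) := by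
  intro z
  have hθ := differentiable_theta1 τ
  by_cases hz : z ∈ (periods τ).lattice
  · -- near `z`, split off the polar part `1 / (w - z) ^ 2` of `℘` and divide `θ₁` by `w - z`
    have heq : thetaSqWp τ =ᶠ[nhds z] fun w => theta1 τ w ^ 2 *
        ((periods τ).weierstrassPExcept z w - 1 / z ^ 2) + dslope (theta1 τ) z w ^ 2 := by
      filter_upwards [(periods τ).compl_lattice_sdiff_singleton_mem_nhds z] with w hw
      by_cases hwz : w = z
      · subst hwz
        rw [thetaSqWp_of_mem hz, dslope_same, theta1_eq_zero_of_mem hz]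
        ring
      · have hw' : w ∉ (periods τ).lattice := fun h => hw ⟨h, hwz⟩
        have hne : w - z ≠ 0 := sub_ne_zero.2 hwz
        rw [thetaSqWp_of_notMem hw', wp, ← (periods τ).weierstrassPExcept_add ⟨z, hz⟩,
          dslope_of_ne _ hwz, slope_def_field, theta1_eq_zero_of_mem hz]
        field_simp
        ring
    refine DifferentiableAt.congr_of_eventuallyEq ?_ heq
    have h1 := ((periods τ).analyticAt_weierstrassPExcept z).differentiableAt
    have h2 : DifferentiableAt ℂ (dslope (theta1 τ) z) z :=
      ((differentiableOn_dslope Filter.univ_mem).2 hθ.differentiableOn).differentiableAt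
        Filter.univ_mem
    have h3 := hθ z
    fun_prop
  · have heq : thetaSqWp τ =ᶠ[nhds z] fun w => theta1 τ w ^ 2 * wp τ w := by
      filter_upwards [(isOpen_compl_lattice τ).mem_nhds hz] with w hw
      exact thetaSqWp_of_notMem hw
    refine DifferentiableAt.congr_of_eventuallyEq ?_ heq
    have h1 := differentiableAt_wp hz
    have h3 := hθ z
    fun_prop

theorem isOrderTwo_thetaSqWp (τ : ℍ) : IsOrderTwo τ (thetaSqWp τ) where
  differentiable := differentiable_thetaSqWp τ
  add_one z := by
    by_cases hz : z ∈ (periods τ).lattice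
    · rw [thetaSqWp_of_mem hz, thetaSqWp_of_mem (add_mem hz (one_mem_lattice τ)),
        ← deriv_comp_add_const, funext (theta1_add_one τ), deriv.fun_neg]
      ring
    · have hz' : z + 1 ∉ (periods τ).lattice := fun h =>
        hz ((add_mem_cancel_right (one_mem_lattice τ)).1 h)
      rw [thetaSqWp_of_notMem hz, thetaSqWp_of_notMem hz', wp_add _ (one_mem_lattice τ),
        theta1_add_one]
      ring
  add_tau z := by
    have h : exp (-Real.pi * I * τ - 2 * Real.pi * I * z) ^ 2 =
        exp (-(2 * Real.pi * I * τ)) * exp (-(4 * Real.pi * I * z)) := by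
      rw [sq, ← exp_add, ← exp_add]
      congr 1
      ring
    by_cases hz : z ∈ (periods τ).lattice
    · have hd := (differentiable_theta1 τ z)
      rw [thetaSqWp_of_mem hz, thetaSqWp_of_mem (add_mem hz (tau_mem_lattice τ)),
        ← deriv_comp_add_const, funext (theta1_add_tau τ), deriv_fun_mul (by fun_prop) hd,
        theta1_eq_zero_of_mem hz, ← h]
      ring
    · have hz' : z + τ ∉ (periods τ).lattice := fun h =>
        hz ((add_mem_cancel_right (tau_mem_lattice τ)).1 h)
      rw [thetaSqWp_of_notMem hz, thetaSqWp_of_notMem hz', wp_add _ (tau_mem_lattice τ),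
        theta1_add_tau, ← h]
      ring

theorem eventually_theta1_ne_zero (τ : ℍ) (z : ℂ) : ∀ᶠ w in nhdsWithin z {z}ᶜ, theta1 τ w ≠ 0 := by
  have han : AnalyticOnNhd ℂ (theta1 τ) Set.univ := fun z _ => (differentiable_theta1 τ).analyticAt z
  by_contra h
  obtain ⟨w, hw⟩ := exists_theta1_ne_zero τ
  exact hw (han.eqOn_zero_of_preconnected_of_frequently_eq_zero isPreconnected_univ
    (Set.mem_univ z) (by simpa [Filter.not_eventually] using h) (Set.mem_univ w))

theorem eventually_notMem_lattice (τ : ℍ) (z : ℂ) :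
    ∀ᶠ w in nhdsWithin z {z}ᶜ, w ∉ (periods τ).lattice := by
  have h := (periods τ).compl_lattice_sdiff_singleton_mem_nhds z
  filter_upwards [nhdsWithin_le_nhds h, self_mem_nhdsWithin] with w hw hwz hmem
  exact hw ⟨hmem, hwz⟩

theorem tendsto_sq_mul_wp (τ : ℍ) :
    Filter.Tendsto (fun z => z ^ 2 * wp τ z) (nhdsWithin 0 {0}ᶜ) (nhds 1) := by
  have h1 : ContinuousAt (fun z => z ^ 2 * (periods τ).weierstrassPExcept 0 z + 1) 0 := by
    have := ((periods τ).analyticAt_weierstrassPExcept 0).continuousAt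
    fun_prop
  have h2 : Filter.Tendsto (fun z => z ^ 2 * (periods τ).weierstrassPExcept 0 z + 1)
      (nhdsWithin 0 {0}ᶜ) (nhds 1) := by
    have h3 := h1.tendsto.mono_left (nhdsWithin_le_nhds (s := {0}ᶜ))
    simpa using h3
  refine h2.congr' ?_
  filter_upwards [self_mem_nhdsWithin] with z hz
  have hz0 : z ≠ 0 := hz
  rw [wp, ← (periods τ).weierstrassPExcept_add ⟨0, zero_mem _⟩]
  field_simp
  simp only [sub_zero, ne_eq, OfNat.ofNat_ne_zero, not_false_eq_true, zero_pow, div_zero]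
  ring

/-- Since `℘` has a pole, `θ₁²` and `θ₁² ℘` are linearly independent. -/
theorem thetaSq_thetaSqWp_independent {τ : ℍ} {α β : ℂ}
    (h : ∀ z, α * theta1 τ z ^ 2 + β * thetaSqWp τ z = 0) : α = 0 ∧ β = 0 := by
  have hβ : β = 0 := by
    have hlim : Filter.Tendsto (fun z => α * z ^ 2 + β * (z ^ 2 * wp τ z))
        (nhdsWithin 0 {0}ᶜ) (nhds (α * 0 ^ 2 + β * 1)) := by
      refine Filter.Tendsto.add ?_ ((tendsto_sq_mul_wp τ).const_mul β)
      refine Filter.Tendsto.mono_left (Continuous.tendsto ?_ 0) nhdsWithin_le_nhds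
      fun_prop
    have hzero : (fun z => α * z ^ 2 + β * (z ^ 2 * wp τ z)) =ᶠ[nhdsWithin 0 {0}ᶜ]
        fun _ => 0 := by
      filter_upwards [eventually_theta1_ne_zero τ 0, eventually_notMem_lattice τ 0] with z h1 h2
      have h3 := h z
      rw [thetaSqWp_of_notMem h2] at h3
      have h4 : theta1 τ z ^ 2 * (α + β * wp τ z) = 0 := by linear_combination h3
      have h5 := (mul_eq_zero.1 h4).resolve_left (pow_ne_zero 2 h1)
      linear_combination z ^ 2 * h5
    have h6 := tendsto_nhds_unique (hlim.congr' hzero) tendsto_const_nhds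
    simpa using h6
  refine ⟨?_, hβ⟩
  obtain ⟨z, hz⟩ := exists_theta1_ne_zero τ
  have h1 := h z
  rw [hβ, zero_mul, add_zero] at h1
  exact (mul_eq_zero.1 h1).resolve_right (pow_ne_zero 2 hz)

theorem exists_theta1_mul_eq (τ : ℍ) (b : ℂ) : ∃ A B : ℂ, ∀ z,
    theta1 τ (z + b) * theta1 τ (z - b) = A * theta1 τ z ^ 2 + B * thetaSqWp τ z := by
  have hsq : IsOrderTwo τ fun z => theta1 τ z ^ 2 := by
    simpa [sq] using isOrderTwo_theta1_mul τ 0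
  obtain ⟨c, hc, hrel⟩ := IsOrderTwo.exists_relation (τ := τ)
    ![fun z => theta1 τ (z + b) * theta1 τ (z - b), fun z => theta1 τ z ^ 2, thetaSqWp τ]
    (by
      intro i
      fin_cases i
      · exact isOrderTwo_theta1_mul τ b
      · exact hsq
      · exact isOrderTwo_thetaSqWp τ)
  simp only [Fin.sum_univ_three, Matrix.cons_val_zero, Matrix.cons_val_one,
    Matrix.cons_val] at hrel
  have hc0 : c 0 ≠ 0 := by
    intro h0
    have h := thetaSq_thetaSqWp_independent (τ := τ) (α := c 1) (β := c 2) fun z => by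
      linear_combination hrel z - h0 * (theta1 τ (z + b) * theta1 τ (z - b))
    exact hc (by ext i; fin_cases i; exacts [h0, h.1, h.2])
  refine ⟨-c 1 / c 0, -c 2 / c 0, fun z => ?_⟩
  field_simp
  linear_combination hrel z

theorem theta1Deriv0_ne_zero (τ : ℍ) : theta1Deriv0 τ ≠ 0 := by
  intro h0
  obtain ⟨b, hb⟩ := exists_theta1_ne_zero τ
  obtain ⟨A, B, h⟩ := exists_theta1_mul_eq τ b
  have h1 := h 0
  rw [zero_add, zero_sub, theta1_neg, theta1_zero, thetaSqWp_zero, h0] at h1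
  have h2 : theta1 τ b ^ 2 = 0 := by linear_combination -h1
  exact hb (pow_eq_zero_iff two_ne_zero |>.1 h2)

/-- The addition formula `θ'(0)² θ(a + b) θ(a - b) = -θ(a)² θ(b)² (℘(a) - ℘(b))`, in a form that
holds at the lattice points too. -/
theorem theta1_addition (τ : ℍ) (a b : ℂ) :
    theta1Deriv0 τ ^ 2 * (theta1 τ (a + b) * theta1 τ (a - b)) =
      theta1 τ a ^ 2 * thetaSqWp τ b - theta1 τ b ^ 2 * thetaSqWp τ a := by
  have hK := theta1Deriv0_ne_zero τ
  choose A B h using exists_theta1_mul_eq τ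
  have hB : ∀ b, theta1Deriv0 τ ^ 2 * B b = -theta1 τ b ^ 2 := by
    intro b
    have h1 := h b 0
    rw [zero_add, zero_sub, theta1_neg, theta1_zero, thetaSqWp_zero] at h1
    linear_combination -h1
  -- the left-hand side is antisymmetric in `a, b`, hence so is the failure of the claimed formula,
  -- which is `θ(a) ^ 2` times a function of `b`
  have hC : ∀ a b, theta1 τ a ^ 2 * (theta1Deriv0 τ ^ 2 * A b - thetaSqWp τ b) =
      -(theta1 τ b ^ 2 * (theta1Deriv0 τ ^ 2 * A a - thetaSqWp τ a)) := by
    intro a b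
    have h1 := h b a
    have h2 := h a b
    have h3 := theta1_neg τ (a - b)
    rw [neg_sub] at h3
    rw [add_comm b a, h3] at h2
    linear_combination theta1Deriv0 τ ^ 2 * (-h1 - h2) - thetaSqWp τ a * hB b -
      thetaSqWp τ b * hB a
  obtain ⟨w, hw⟩ := exists_theta1_ne_zero τ
  have hw2 := pow_ne_zero 2 hw
  have hCw : theta1Deriv0 τ ^ 2 * A w - thetaSqWp τ w = 0 := by
    have h1 := hC w w
    have h2 : theta1 τ w ^ 2 * (theta1Deriv0 τ ^ 2 * A w - thetaSqWp τ w) = 0 := by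
      linear_combination h1 / 2
    exact (mul_eq_zero.1 h2).resolve_left hw2
  have hCb : theta1Deriv0 τ ^ 2 * A b - thetaSqWp τ b = 0 := by
    have h1 := hC w b
    rw [hCw, mul_zero, neg_zero] at h1
    exact (mul_eq_zero.1 h1).resolve_left hw2
  linear_combination theta1Deriv0 τ ^ 2 * h b a + theta1 τ a ^ 2 * hCb + thetaSqWp τ a * hB b

/-- A zero of `θ₁` outside the lattice would, by the addition formula, make `θ₁` vanish
identically. -/
theorem theta1_ne_zero {τ : ℍ} {a : ℂ} (ha : a ∉ (periods τ).lattice) : theta1 τ a ≠ 0 := by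
  intro h0
  have hprod : ∀ b, theta1 τ (a + b) * theta1 τ (a - b) = 0 := by
    intro b
    have h1 := theta1_addition τ a b
    rw [thetaSqWp_of_notMem ha, h0] at h1
    have h2 : theta1Deriv0 τ ^ 2 * (theta1 τ (a + b) * theta1 τ (a - b)) = 0 := by
      linear_combination h1
    exact (mul_eq_zero.1 h2).resolve_left (pow_ne_zero 2 (theta1Deriv0_ne_zero τ))
  have hd := differentiable_theta1 τ
  have han : ∀ f : ℂ → ℂ, Differentiable ℂ f → AnalyticOnNhd ℂ f Set.univ :=
    fun f hf z _ => hf.analyticAt z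
  obtain ⟨w, hw⟩ := exists_theta1_ne_zero τ
  rcases (han (fun b => theta1 τ (a + b)) (by fun_prop)).eq_zero_or_eq_zero_of_mul_eq_zero
    (han (fun b => theta1 τ (a - b)) (by fun_prop)) (fun b _ => hprod b) isPreconnected_univ
    with h | h
  · exact hw (by simpa using h (w - a) (Set.mem_univ _))
  · exact hw (by simpa using h (a - w) (Set.mem_univ _))

theorem wp_sub_wp {τ : ℍ} {a b : ℂ} (ha : a ∉ (periods τ).lattice)
    (hb : b ∉ (periods τ).lattice) :
    theta1Deriv0 τ ^ 2 * (theta1 τ (a + b) * theta1 τ (a - b)) =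
      -(theta1 τ a ^ 2 * theta1 τ b ^ 2 * (wp τ a - wp τ b)) := by
  rw [theta1_addition, thetaSqWp_of_notMem ha, thetaSqWp_of_notMem hb]
  ring

/-- Weierstrass' three-term identity. -/
theorem theta1_three_term (τ : ℍ) (a b c d : ℂ) :
    theta1 τ (a + b) * theta1 τ (a - b) * (theta1 τ (c + d) * theta1 τ (c - d)) +
      theta1 τ (a + c) * theta1 τ (a - c) * (theta1 τ (d + b) * theta1 τ (d - b)) +
      theta1 τ (a + d) * theta1 τ (a - d) * (theta1 τ (b + c) * theta1 τ (b - c)) = 0 := by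
  have hK := pow_ne_zero 2 (pow_ne_zero 2 (theta1Deriv0_ne_zero τ))
  refine (mul_eq_zero.1 ?_).resolve_left hK
  have h : ∀ x y, theta1Deriv0 τ ^ 2 * (theta1 τ (x + y) * theta1 τ (x - y)) =
    theta1 τ x ^ 2 * thetaSqWp τ y - theta1 τ y ^ 2 * thetaSqWp τ x := theta1_addition τ
  calc _ = theta1Deriv0 τ ^ 2 * (theta1 τ (a + b) * theta1 τ (a - b)) *
        (theta1Deriv0 τ ^ 2 * (theta1 τ (c + d) * theta1 τ (c - d))) +
      theta1Deriv0 τ ^ 2 * (theta1 τ (a + c) * theta1 τ (a - c)) *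
        (theta1Deriv0 τ ^ 2 * (theta1 τ (d + b) * theta1 τ (d - b))) +
      theta1Deriv0 τ ^ 2 * (theta1 τ (a + d) * theta1 τ (a - d)) *
        (theta1Deriv0 τ ^ 2 * (theta1 τ (b + c) * theta1 τ (b - c))) := by ring
    _ = 0 := by
      rw [h, h, h, h, h, h]
      ring

/-- The duplication formula for `℘'`. -/
theorem deriv_wp_mul {τ : ℍ} {z : ℂ} (hz : z ∉ (periods τ).lattice) :
    deriv (wp τ) z * theta1 τ z ^ 4 = -(theta1Deriv0 τ ^ 3 * theta1 τ (2 * z)) := by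
  have hθ := differentiable_theta1 τ
  have hwp := (differentiableAt_wp hz).hasDerivAt
  have h1 : HasDerivAt (fun w => theta1Deriv0 τ ^ 2 * (theta1 τ (w + z) * theta1 τ (w - z)))
      (theta1Deriv0 τ ^ 2 * (deriv (theta1 τ) (z + z) * theta1 τ (z - z) +
        theta1 τ (z + z) * deriv (theta1 τ) (z - z))) z :=
    ((HasDerivAt.comp_add_const z z (hθ (z + z)).hasDerivAt).mul
      (HasDerivAt.comp_sub_const z z (hθ (z - z)).hasDerivAt)).const_mul _
  have h2 : HasDerivAt (fun w => -(theta1 τ w ^ 2 * theta1 τ z ^ 2 * (wp τ w - wp τ z)))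
      (-(2 * theta1 τ z * deriv (theta1 τ) z * theta1 τ z ^ 2 * (wp τ z - wp τ z) +
        theta1 τ z ^ 2 * theta1 τ z ^ 2 * deriv (wp τ) z)) z := by
    have h3 := (((hθ z).hasDerivAt.fun_pow 2).mul_const (theta1 τ z ^ 2)).fun_mul
      (hwp.sub_const (wp τ z))
    refine h3.fun_neg.congr_deriv ?_
    push_cast
    ring
  have heq : (fun w => theta1Deriv0 τ ^ 2 * (theta1 τ (w + z) * theta1 τ (w - z))) =ᶠ[nhds z]
      fun w => -(theta1 τ w ^ 2 * theta1 τ z ^ 2 * (wp τ w - wp τ z)) := by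
    filter_upwards [(isOpen_compl_lattice τ).mem_nhds hz] with w hw
    exact wp_sub_wp hw hz
  have h4 := (h1.congr_of_eventuallyEq heq.symm).unique h2
  rw [sub_self, theta1_zero, ← two_mul, sub_self, show deriv (theta1 τ) 0 = theta1Deriv0 τ from rfl]
    at h4
  linear_combination h4

/-! ### Half-periods -/

theorem halfPeriod_zero (τ : ℍ) : halfPeriod τ 0 = 0 := rfl
theorem halfPeriod_one (τ : ℍ) : halfPeriod τ 1 = 1 / 2 := rfl
theorem halfPeriod_two (τ : ℍ) : halfPeriod τ 2 = (1 + τ) / 2 := rfl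
theorem halfPeriod_three (τ : ℍ) : halfPeriod τ 3 = τ / 2 := rfl
theorem dHalfPeriod_zero : dHalfPeriod 0 = 0 := rfl
theorem dHalfPeriod_one : dHalfPeriod 1 = 0 := rfl
theorem dHalfPeriod_two : dHalfPeriod 2 = 1 / 2 := rfl
theorem dHalfPeriod_three : dHalfPeriod 3 = 1 / 2 := rfl

theorem two_mul_halfPeriod_mem (τ : ℍ) (a : Fin 4) :
    2 * halfPeriod τ a ∈ (periods τ).lattice := by
  fin_cases a
  · simp [halfPeriod]
  · simpa [halfPeriod] using one_mem_lattice τ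
  · have h := add_mem (one_mem_lattice τ) (tau_mem_lattice τ)
    convert h using 1
    simp only [Fin.reduceFinMk, halfPeriod_two]
    ring
  · convert tau_mem_lattice τ using 1
    simp only [Fin.reduceFinMk, halfPeriod_three]
    ring

theorem halfPeriod_notMem (τ : ℍ) {k : Fin 4} (hk : k ≠ 0) :
    halfPeriod τ k ∉ (periods τ).lattice := by
  have hden : ((1 / 2 : ℚ)).den ≠ 1 := by norm_num
  have key : ∀ α β : ℚ, (α.den ≠ 1 ∨ β.den ≠ 1) →
      (α * 1 + β * τ : ℂ) ∉ (periods τ).lattice := by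
    intro α β h hmem
    have := (PeriodPair.mul_ω₁_add_mul_ω₂_mem_lattice (L := periods τ) (α := α) (β := β)).1 hmem
    tauto
  fin_cases k
  · exact absurd rfl hk
  · have h := key (1 / 2) 0 (Or.inl hden)
    convert h using 2
    simp [halfPeriod]
  · have h := key (1 / 2) (1 / 2) (Or.inl hden)
    convert h using 2
    simp only [Fin.reduceFinMk, halfPeriod_two]
    push_cast
    ring
  · have h := key 0 (1 / 2) (Or.inr hden)
    convert h using 2
    simp only [Fin.reduceFinMk, halfPeriod_three]
    push_cast
    ring

theorem add_halfPeriod_notMem {τ : ℍ} {η : ℂ} (hη : 2 * η ∉ (periods τ).lattice) (a : Fin 4) :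
    η + halfPeriod τ a ∉ (periods τ).lattice := by
  intro h
  apply hη
  have h1 := sub_mem (add_mem h h) (two_mul_halfPeriod_mem τ a)
  convert h1 using 1
  ring

/-- Reflection of `θ₁` in a half-period. -/
theorem theta1_halfPeriod_sub (τ : ℍ) {k : Fin 4} (hk : k ≠ 0) (z : ℂ) :
    theta1 τ (halfPeriod τ k - z) =
      exp (2 * Real.pi * I * z * dHalfPeriod k) ^ 2 * theta1 τ (z + halfPeriod τ k) := by
  rw [← neg_sub, theta1_neg, sq, ← exp_add]
  fin_cases k
  · exact absurd rfl hk
  · simp only [Fin.mk_one, halfPeriod_one, dHalfPeriod_one]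
    rw [show z + 1 / 2 = z - 1 / 2 + 1 by ring, theta1_add_one]
    simp
  · simp only [Fin.reduceFinMk, halfPeriod_two, dHalfPeriod_two]
    rw [show z + (1 + τ) / 2 = z - (1 + τ) / 2 + 1 + τ by ring, theta1_add_tau, theta1_add_one]
    have h : exp (2 * Real.pi * I * z * (1 / 2) + 2 * Real.pi * I * z * (1 / 2)) *
        exp (-Real.pi * I * τ - 2 * Real.pi * I * (z - (1 + τ) / 2 + 1)) = -1 := by
      rw [← exp_add]
      exact (congrArg exp (by ring)).trans exp_neg_pi_mul_I
    linear_combination (-theta1 τ (z - (1 + τ) / 2)) * h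
  · simp only [Fin.reduceFinMk, halfPeriod_three, dHalfPeriod_three]
    rw [show z + τ / 2 = z - τ / 2 + τ by ring, theta1_add_tau]
    have h : exp (2 * Real.pi * I * z * (1 / 2) + 2 * Real.pi * I * z * (1 / 2)) *
        exp (-Real.pi * I * τ - 2 * Real.pi * I * (z - τ / 2)) = 1 := by
      rw [← exp_add]
      exact (congrArg exp (by ring)).trans exp_zero
    linear_combination (theta1 τ (z - τ / 2)) * h

/-! ### The Kronecker function -/

/-- The exponential factors of `φ_a(z, x)` and `φ_b(-z, x)` with equal `∂_τ ω` cancel. -/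
theorem exp_mul_exp_neg_mul (z d : ℂ) :
    exp (2 * Real.pi * I * z * d) * exp (2 * Real.pi * I * -z * d) = 1 := by
  rw [← exp_add, ← exp_zero]
  congr 1
  ring

theorem kronecker_mul_neg {τ : ℍ} {z x : ℂ} (hz : z ∉ (periods τ).lattice)
    (hx : x ∉ (periods τ).lattice) :
    kronecker τ z x * kronecker τ (-z) x = wp τ x - wp τ z := by
  have hz' := theta1_ne_zero hz
  have hx' := theta1_ne_zero hx
  have h := wp_sub_wp hx hz
  rw [kronecker, kronecker, neg_add_eq_sub, theta1_neg, add_comm z x, div_mul_div_comm,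
    div_eq_iff (by simp [hz', hx'])]
  linear_combination h

theorem varphi_mul_neg {τ : ℍ} (a : Fin 4) {z x : ℂ} (hz : z ∉ (periods τ).lattice)
    (hx : x + halfPeriod τ a ∉ (periods τ).lattice) :
    varphi τ a z x * varphi τ a (-z) x = wp τ (x + halfPeriod τ a) - wp τ z := by
  rw [← kronecker_mul_neg hz hx, varphi, varphi]
  linear_combination (kronecker τ z (x + halfPeriod τ a) *
    kronecker τ (-z) (x + halfPeriod τ a)) * exp_mul_exp_neg_mul z (dHalfPeriod a)

theorem varphi₀_eq (τ : ℍ) (k : Fin 4) (z : ℂ) : varphi₀ τ k z =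
    exp (2 * Real.pi * I * z * dHalfPeriod k) * kronecker τ z (halfPeriod τ k) := by
  rw [varphi₀, varphi, zero_add]

theorem varphi₀_neg (τ : ℍ) {k : Fin 4} (hk : k ≠ 0) (z : ℂ) :
    varphi₀ τ k (-z) = -varphi₀ τ k z := by
  rw [varphi₀_eq, varphi₀_eq, kronecker, kronecker, neg_add_eq_sub, theta1_halfPeriod_sub τ hk,
    theta1_neg, neg_mul (theta1 τ z), div_neg]
  have h := exp_mul_exp_neg_mul z (dHalfPeriod k)
  linear_combination (-exp (2 * Real.pi * I * z * dHalfPeriod k) * (theta1Deriv0 τ *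
    theta1 τ (z + halfPeriod τ k) / (theta1 τ z * theta1 τ (halfPeriod τ k)))) * h

theorem varphi₀_sq {τ : ℍ} {k : Fin 4} (hk : k ≠ 0) {z : ℂ} (hz : z ∉ (periods τ).lattice) :
    varphi₀ τ k z ^ 2 = wp τ z - wp τ (halfPeriod τ k) := by
  have h := varphi_mul_neg k (x := 0) hz (by rw [zero_add]; exact halfPeriod_notMem τ hk)
  have h1 := varphi₀_neg τ hk z
  rw [varphi₀, varphi₀] at h1
  rw [h1, zero_add] at h
  rw [varphi₀]
  linear_combination -h

/-- The three-term identity at half-integer shifts by `ω = ω_k`. -/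
theorem theta1_half_three_term (τ : ℍ) {k : Fin 4} (hk : k ≠ 0) (z u : ℂ) :
    theta1 τ z * theta1 τ (z + halfPeriod τ k) *
      (theta1 τ (z + u) * theta1 τ (-z + (u + halfPeriod τ k)) +
        exp (2 * Real.pi * I * z * dHalfPeriod k) ^ 2 *
          (theta1 τ (z + (u + halfPeriod τ k)) * theta1 τ (-z + u))) =
      theta1 τ (u + halfPeriod τ k) * theta1 τ u *
        (theta1 τ (2 * z) * theta1 τ (halfPeriod τ k)) := by
  have h := theta1_three_term τ (u + halfPeriod τ k / 2) (z - halfPeriod τ k / 2)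
    (z + halfPeriod τ k / 2) (halfPeriod τ k / 2)
  have hs := theta1_halfPeriod_sub τ hk z
  have hn := theta1_neg τ (halfPeriod τ k)
  rw [show u + halfPeriod τ k / 2 + (z - halfPeriod τ k / 2) = z + u by ring,
    show u + halfPeriod τ k / 2 - (z - halfPeriod τ k / 2) = -z + (u + halfPeriod τ k) by ring,
    show z + halfPeriod τ k / 2 + halfPeriod τ k / 2 = z + halfPeriod τ k by ring,
    show z + halfPeriod τ k / 2 - halfPeriod τ k / 2 = z by ring,
    show u + halfPeriod τ k / 2 + (z + halfPeriod τ k / 2) = z + (u + halfPeriod τ k) by ring,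
    show u + halfPeriod τ k / 2 - (z + halfPeriod τ k / 2) = -z + u by ring,
    show halfPeriod τ k / 2 + (z - halfPeriod τ k / 2) = z by ring,
    show halfPeriod τ k / 2 - (z - halfPeriod τ k / 2) = halfPeriod τ k - z by ring,
    show u + halfPeriod τ k / 2 + halfPeriod τ k / 2 = u + halfPeriod τ k by ring,
    show u + halfPeriod τ k / 2 - halfPeriod τ k / 2 = u by ring,
    show z - halfPeriod τ k / 2 + (z + halfPeriod τ k / 2) = 2 * z by ring,
    show z - halfPeriod τ k / 2 - (z + halfPeriod τ k / 2) = -halfPeriod τ k by ring, hs, hn] at h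
  linear_combination h

/-- The symmetrized product of `φ₀` and `φ_k` does not depend on `u`. Here it is multiplied by
`φ_k(z)`, which may vanish. -/
theorem varphi₀_mul_varphi_symm {τ : ℍ} {k : Fin 4} (hk : k ≠ 0) {z u : ℂ}
    (hz : z ∉ (periods τ).lattice) (hu : u ∉ (periods τ).lattice)
    (huk : u + halfPeriod τ k ∉ (periods τ).lattice) :
    varphi₀ τ k z * (varphi τ 0 z u * varphi τ k (-z) u + varphi τ k z u * varphi τ 0 (-z) u) =
      deriv (wp τ) z := by
  have h1 := theta1_ne_zero hz
  have h2 := theta1_ne_zero hu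
  have h3 := theta1_ne_zero huk
  have h4 := theta1_ne_zero (halfPeriod_notMem τ hk)
  have hT := theta1_half_three_term τ hk z u
  have hd := deriv_wp_mul hz
  have he := exp_mul_exp_neg_mul z (dHalfPeriod k)
  rw [varphi₀_eq, varphi, varphi, varphi, varphi, dHalfPeriod_zero, halfPeriod_zero, mul_zero,
    mul_zero, exp_zero, one_mul, one_mul, add_zero]
  simp only [kronecker, theta1_neg]
  have hd' : deriv (wp τ) z = -(theta1Deriv0 τ ^ 3 * theta1 τ (2 * z)) / theta1 τ z ^ 4 := by
    rw [eq_div_iff (pow_ne_zero 4 h1), hd]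
  rw [hd']
  generalize exp (2 * Real.pi * I * z * dHalfPeriod k) = e at *
  generalize exp (2 * Real.pi * I * -z * dHalfPeriod k) = e' at *
  generalize theta1 τ (2 * z) = t2 at *
  generalize theta1 τ (z + (u + halfPeriod τ k)) = t3 at *
  generalize theta1 τ (-z + (u + halfPeriod τ k)) = t4 at *
  generalize theta1 τ (u + halfPeriod τ k) = t5 at *
  generalize theta1 τ (z + halfPeriod τ k) = t6 at *
  generalize theta1 τ (halfPeriod τ k) = t7 at *
  generalize theta1 τ (-z + u) = t8 at *
  generalize theta1 τ (z + u) = t9 at *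
  generalize theta1 τ u = t10 at *
  generalize theta1 τ z = t11 at *
  generalize theta1Deriv0 τ = K at *
  field_simp
  linear_combination -K ^ 3 * hT - K ^ 3 * t6 * t11 * t9 * t4 * he

/-! ### Half-period shifts, symmetrized products and derivatives -/

theorem kronecker_add_one (τ : ℍ) (z x : ℂ) : kronecker τ z (x + 1) = kronecker τ z x := by
  rw [kronecker, kronecker, ← add_assoc, theta1_add_one, theta1_add_one, mul_neg, mul_neg,
    neg_div_neg_eq]

theorem varphi_zero_add_one_half (τ : ℍ) (z u : ℂ) :
    varphi τ 0 z (u + halfPeriod τ 1) = varphi τ 1 z u := by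
  rw [varphi, varphi, dHalfPeriod_zero, dHalfPeriod_one, halfPeriod_zero, add_zero]

theorem varphi_two_add_one_half (τ : ℍ) (z u : ℂ) :
    varphi τ 2 z (u + halfPeriod τ 1) = varphi τ 3 z u := by
  rw [varphi, varphi, dHalfPeriod_two, dHalfPeriod_three, halfPeriod_two, halfPeriod_three,
    halfPeriod_one, show u + 1 / 2 + (1 + τ) / 2 = u + τ / 2 + 1 by ring, kronecker_add_one]

theorem varphi_three_add_one_half (τ : ℍ) (z u : ℂ) :
    varphi τ 3 z (u + halfPeriod τ 1) = varphi τ 2 z u := by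
  rw [varphi, varphi, dHalfPeriod_two, dHalfPeriod_three, halfPeriod_two, halfPeriod_three,
    halfPeriod_one, show u + 1 / 2 + τ / 2 = u + (1 + τ) / 2 by ring]

theorem varphi_zero_add_halfPeriod_two (τ : ℍ) (z u : ℂ) :
    varphi τ 0 z (u + halfPeriod τ 2) =
      exp (2 * Real.pi * I * -z * (1 / 2)) * varphi τ 2 z u := by
  rw [varphi, varphi, dHalfPeriod_two, dHalfPeriod_zero, halfPeriod_zero, add_zero, mul_zero,
    exp_zero]
  linear_combination (-kronecker τ z (u + halfPeriod τ 2)) * exp_mul_exp_neg_mul z (1 / 2)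

theorem varphi_one_add_halfPeriod_two (τ : ℍ) (z u : ℂ) :
    varphi τ 1 z (u + halfPeriod τ 2) =
      exp (2 * Real.pi * I * -z * (1 / 2)) * varphi τ 3 z u := by
  rw [varphi, varphi, dHalfPeriod_three, dHalfPeriod_one, halfPeriod_two, halfPeriod_three,
    halfPeriod_one, mul_zero, exp_zero,
    show u + (1 + τ) / 2 + 1 / 2 = u + τ / 2 + 1 by ring, kronecker_add_one]
  linear_combination (-kronecker τ z (u + τ / 2)) * exp_mul_exp_neg_mul z (1 / 2)

theorem varphi_zero_right (τ : ℍ) (a : Fin 4) (z : ℂ) : varphi τ a z 0 = varphi₀ τ a z := rfl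

/-- The factorization of `℘'`, obtained by evaluating the symmetrized product of `φ₀` and `φ₁` at
`u = ω₂`. -/
theorem deriv_wp_eq {τ : ℍ} {z : ℂ} (hz : z ∉ (periods τ).lattice) :
    deriv (wp τ) z = -2 * (varphi₀ τ 1 z * varphi₀ τ 2 z * varphi₀ τ 3 z) := by
  have h12 : halfPeriod τ 2 + halfPeriod τ 1 ∉ (periods τ).lattice := by
    have h := halfPeriod_notMem τ (k := 3) (by decide)
    intro hmem
    apply h
    have h1 := sub_mem hmem (one_mem_lattice τ)
    convert h1 using 1
    rw [halfPeriod_one, halfPeriod_two, halfPeriod_three]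
    ring
  rw [← varphi₀_mul_varphi_symm (k := 1) one_ne_zero hz
    (halfPeriod_notMem τ (k := 2) (by decide)) h12, ← zero_add (halfPeriod τ 2),
    varphi_zero_add_halfPeriod_two, varphi_zero_add_halfPeriod_two, varphi_one_add_halfPeriod_two,
    varphi_one_add_halfPeriod_two]
  simp only [varphi_zero_right]
  rw [varphi₀_neg τ (k := 2) (by decide), varphi₀_neg τ (k := 3) (by decide), neg_neg]
  linear_combination (-2 * (varphi₀ τ 1 z * varphi₀ τ 2 z * varphi₀ τ 3 z)) *
    exp_mul_exp_neg_mul z (1 / 2)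

theorem differentiableAt_varphi {τ : ℍ} (a : Fin 4) {z x : ℂ} (hz : z ∉ (periods τ).lattice)
    (hx : x + halfPeriod τ a ∉ (periods τ).lattice) :
    DifferentiableAt ℂ (fun z => varphi τ a z x) z := by
  have hθ := differentiable_theta1 τ
  unfold varphi kronecker
  refine DifferentiableAt.mul (by fun_prop) (DifferentiableAt.div (by fun_prop) (by fun_prop) ?_)
  exact mul_ne_zero (theta1_ne_zero hz) (theta1_ne_zero hx)

theorem differentiableAt_varphi₀ {τ : ℍ} {k : Fin 4} (hk : k ≠ 0) {z : ℂ}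
    (hz : z ∉ (periods τ).lattice) : DifferentiableAt ℂ (varphi₀ τ k) z :=
  differentiableAt_varphi k hz (by rw [zero_add]; exact halfPeriod_notMem τ hk)

theorem neg_notMem {τ : ℍ} {z : ℂ} (hz : z ∉ (periods τ).lattice) :
    -z ∉ (periods τ).lattice := by simpa using hz

/-- A function holomorphic off the lattice vanishes there as soon as its product with `φ_k`
does. -/
theorem eq_zero_of_varphi₀_mul {τ : ℍ} {k : Fin 4} (hk : k ≠ 0) {g : ℂ → ℂ}
    (hg : DifferentiableOn ℂ g (((periods τ).lattice : Set ℂ)ᶜ))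
    (h : ∀ z ∉ (periods τ).lattice, varphi₀ τ k z * g z = 0) {z : ℂ}
    (hz : z ∉ (periods τ).lattice) : g z = 0 := by
  have hf : DifferentiableOn ℂ (varphi₀ τ k) (((periods τ).lattice : Set ℂ)ᶜ) :=
    fun w hw => (differentiableAt_varphi₀ hk hw).differentiableWithinAt
  rcases (hf.analyticOnNhd (isOpen_compl_lattice τ)).eq_zero_or_eq_zero_of_mul_eq_zero
    (hg.analyticOnNhd (isOpen_compl_lattice τ)) h (isPreconnected_compl_lattice τ) with h0 | h0
  · exfalso
    -- `φ_k` vanishes only where `θ₁ (z + ω_k)` does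
    have hev := ((eventually_theta1_ne_zero τ (halfPeriod τ k)).and
      (eventually_notMem_lattice τ (halfPeriod τ k)))
    have hev0 := (isOpen_compl_lattice τ).mem_nhds (halfPeriod_notMem τ hk)
    have hev1 := eventually_notMem_lattice τ (2 * halfPeriod τ k)
    have hmap : Filter.Tendsto (fun w => w + halfPeriod τ k)
        (nhdsWithin (halfPeriod τ k) {halfPeriod τ k}ᶜ)
        (nhdsWithin (2 * halfPeriod τ k) {2 * halfPeriod τ k}ᶜ) := by
      refine tendsto_nhdsWithin_iff.2 ⟨?_, ?_⟩
      · have hc : Continuous fun w => w + halfPeriod τ k := by fun_prop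
        exact (hc.tendsto' _ _ (two_mul _).symm).mono_left nhdsWithin_le_nhds
      · filter_upwards [self_mem_nhdsWithin] with w hw hw'
        apply hw
        simp only [Set.mem_singleton_iff] at hw' ⊢
        linear_combination hw'
    obtain ⟨w, hw1, hw2⟩ := ((hmap.eventually hev1).and (nhdsWithin_le_nhds hev0)).exists
    have h1 := h0 w hw2
    rw [varphi₀_eq, kronecker] at h1
    have := theta1Deriv0_ne_zero τ
    have := theta1_ne_zero hw1
    have := theta1_ne_zero hw2
    have := theta1_ne_zero (halfPeriod_notMem τ hk)
    simp_all [exp_ne_zero]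
  · exact h0 z hz

theorem differentiableOn_symm {τ : ℍ} (a b : Fin 4) {u : ℂ}
    (ha : u + halfPeriod τ a ∉ (periods τ).lattice)
    (hb : u + halfPeriod τ b ∉ (periods τ).lattice) :
    DifferentiableOn ℂ
      (fun z => varphi τ a z u * varphi τ b (-z) u + varphi τ b z u * varphi τ a (-z) u)
      (((periods τ).lattice : Set ℂ)ᶜ) := by
  intro z hz
  refine DifferentiableAt.differentiableWithinAt ?_
  have h1 := differentiableAt_varphi a hz ha
  have h2 := differentiableAt_varphi b hz hb
  have h3 : DifferentiableAt ℂ (fun z => varphi τ a (-z) u) z :=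
    DifferentiableAt.comp z (f := fun z : ℂ => -z)
      (differentiableAt_varphi a (neg_notMem hz) ha) (by fun_prop)
  have h4 : DifferentiableAt ℂ (fun z => varphi τ b (-z) u) z :=
    DifferentiableAt.comp z (f := fun z : ℂ => -z)
      (differentiableAt_varphi b (neg_notMem hz) hb) (by fun_prop)
  fun_prop

/-- The general relation follows from its multiple by `φ_α(z)`, by analyticity in `z`. -/
theorem varphi_symm_zero {τ : ℍ} {α β γ : Fin 4} (hα : α ≠ 0) (hβ : β ≠ 0) (hγ : γ ≠ 0)
    (hp : ∀ z, varphi₀ τ 1 z * varphi₀ τ 2 z * varphi₀ τ 3 z =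
      varphi₀ τ α z * varphi₀ τ β z * varphi₀ τ γ z) {z u : ℂ}
    (hz : z ∉ (periods τ).lattice) (hu : u ∉ (periods τ).lattice)
    (huk : u + halfPeriod τ α ∉ (periods τ).lattice) :
    varphi τ 0 z u * varphi τ α (-z) u + varphi τ α z u * varphi τ 0 (-z) u =
      -2 * (varphi₀ τ β z * varphi₀ τ γ z) := by
  have hu0 : u + halfPeriod τ 0 ∉ (periods τ).lattice := by rwa [halfPeriod_zero, add_zero]
  have hd : DifferentiableOn ℂ (fun z => (varphi τ 0 z u * varphi τ α (-z) u +
      varphi τ α z u * varphi τ 0 (-z) u) + 2 * (varphi₀ τ β z * varphi₀ τ γ z))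
      (((periods τ).lattice : Set ℂ)ᶜ) := by
    refine (differentiableOn_symm 0 α hu0 huk).add fun z hz => ?_
    have h1 := differentiableAt_varphi₀ hβ hz
    have h2 := differentiableAt_varphi₀ hγ hz
    exact DifferentiableAt.differentiableWithinAt (by fun_prop)
  have h := eq_zero_of_varphi₀_mul hα hd (fun w hw => by
    have h1 := varphi₀_mul_varphi_symm hα hw hu huk
    rw [deriv_wp_eq hw, hp] at h1
    linear_combination h1) hz
  linear_combination h

/-- Differentiating `φ_α² = ℘ - ℘(ω_α)` gives the relation multiplied by `φ_α`. -/
theorem deriv_varphi₀_of_prod {τ : ℍ} {α β γ : Fin 4} (hα : α ≠ 0) (hβ : β ≠ 0) (hγ : γ ≠ 0)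
    (hp : ∀ z, varphi₀ τ 1 z * varphi₀ τ 2 z * varphi₀ τ 3 z =
      varphi₀ τ α z * varphi₀ τ β z * varphi₀ τ γ z) {z : ℂ}
    (hz : z ∉ (periods τ).lattice) :
    deriv (varphi₀ τ α) z = -(varphi₀ τ β z * varphi₀ τ γ z) := by
  have hdα : DifferentiableOn ℂ (varphi₀ τ α) (((periods τ).lattice : Set ℂ)ᶜ) :=
    fun w hw => (differentiableAt_varphi₀ hα hw).differentiableWithinAt
  have hd : DifferentiableOn ℂ (fun z => deriv (varphi₀ τ α) z + varphi₀ τ β z * varphi₀ τ γ z)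
      (((periods τ).lattice : Set ℂ)ᶜ) := by
    refine (hdα.deriv (isOpen_compl_lattice τ)).add fun z hz => ?_
    have h1 := differentiableAt_varphi₀ hβ hz
    have h2 := differentiableAt_varphi₀ hγ hz
    exact DifferentiableAt.differentiableWithinAt (by fun_prop)
  have h := eq_zero_of_varphi₀_mul hα hd (fun w hw => by
    have h1 := (differentiableAt_varphi₀ hα hw).hasDerivAt.fun_pow 2
    have h2 := (differentiableAt_wp hw).hasDerivAt.sub_const (wp τ (halfPeriod τ α))
    have heq : (fun z => varphi₀ τ α z ^ 2) =ᶠ[nhds w]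
        fun z => wp τ z - wp τ (halfPeriod τ α) := by
      filter_upwards [(isOpen_compl_lattice τ).mem_nhds hw] with x hx
      exact varphi₀_sq hα hx
    have h3 := (h1.congr_of_eventuallyEq heq.symm).unique h2
    rw [deriv_wp_eq hw, hp] at h3
    push_cast at h3
    linear_combination h3 / 2) hz
  linear_combination h

/-! ### The structure constants -/

theorem wp_halfPeriod_sub {τ : ℍ} {j k : Fin 4} (hj : j ≠ 0) (hk : k ≠ 0) :
    wp τ (halfPeriod τ j) - wp τ (halfPeriod τ k) = varphi₀ τ k (halfPeriod τ j) ^ 2 :=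
  (varphi₀_sq hk (halfPeriod_notMem τ hj)).symm

theorem cConst_one (τ : ℍ) :
    cConst τ 1 = -(theta1 τ (halfPeriod τ 1) / theta1Deriv0 τ) ^ 2 := by
  rw [halfPeriod_one, ← theta2_zero]
  rfl

theorem cConst_two (τ : ℍ) : cConst τ 2 =
    -I * (exp (Real.pi * I * τ / 4) * theta1 τ (halfPeriod τ 2) / theta1Deriv0 τ) ^ 2 := by
  rw [halfPeriod_two, ← theta3_zero]
  rfl

theorem cConst_three (τ : ℍ) : cConst τ 3 =
    (exp (Real.pi * I * τ / 4) * theta1 τ (halfPeriod τ 3) / theta1Deriv0 τ) ^ 2 := by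
  have h : cConst τ 3 = -(theta4 τ 0 / theta1Deriv0 τ) ^ 2 := rfl
  rw [h, theta4_zero, halfPeriod_three]
  linear_combination (-(exp (Real.pi * I * τ / 4) * theta1 τ (τ / 2) / theta1Deriv0 τ) ^ 2) *
    I_mul_I

theorem cConst_ne_zero (τ : ℍ) {k : Fin 4} (hk : k ≠ 0) : cConst τ k ≠ 0 := by
  have hK := theta1Deriv0_ne_zero τ
  have h := theta1_ne_zero (halfPeriod_notMem τ hk)
  fin_cases k
  · exact absurd rfl hk
  · rw [Fin.mk_one, cConst_one]
    exact neg_ne_zero.2 (pow_ne_zero 2 (div_ne_zero h hK))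
  · simp only [Fin.reduceFinMk, cConst_two] at h ⊢
    exact mul_ne_zero (neg_ne_zero.2 I_ne_zero)
      (pow_ne_zero 2 (div_ne_zero (mul_ne_zero (exp_ne_zero _) h) hK))
  · simp only [Fin.reduceFinMk, cConst_three] at h ⊢
    exact pow_ne_zero 2 (div_ne_zero (mul_ne_zero (exp_ne_zero _) h) hK)

theorem cConst_mul_one_two (τ : ℍ) :
    cConst τ 1 * cConst τ 2 * (wp τ (halfPeriod τ 1) - wp τ (halfPeriod τ 2)) =
      -I * cConst τ 3 := by
  have hK := theta1Deriv0_ne_zero τ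
  have h1 := theta1_ne_zero (halfPeriod_notMem τ (k := 1) (by decide))
  have h2 := theta1_ne_zero (halfPeriod_notMem τ (k := 2) (by decide))
  have hs : theta1 τ (halfPeriod τ 2 + halfPeriod τ 1) = -theta1 τ (halfPeriod τ 3) := by
    rw [← theta1_add_one, halfPeriod_one, halfPeriod_two, halfPeriod_three]
    congr 1
    ring
  rw [← neg_sub (wp τ (halfPeriod τ 2)), wp_halfPeriod_sub (by decide) (by decide), varphi₀_eq,
    kronecker, hs, dHalfPeriod_one, mul_zero, exp_zero, cConst_one, cConst_two, cConst_three]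
  field_simp

theorem cConst_mul_two_three (τ : ℍ) :
    cConst τ 2 * cConst τ 3 * (wp τ (halfPeriod τ 2) - wp τ (halfPeriod τ 3)) =
      -I * cConst τ 1 := by
  have hK := theta1Deriv0_ne_zero τ
  have h2 := theta1_ne_zero (halfPeriod_notMem τ (k := 2) (by decide))
  have h3 := theta1_ne_zero (halfPeriod_notMem τ (k := 3) (by decide))
  have hs : theta1 τ (halfPeriod τ 2 + halfPeriod τ 3) =
      exp (-(Real.pi * I * τ)) * theta1 τ (halfPeriod τ 1) := by
    rw [halfPeriod_one, halfPeriod_two, halfPeriod_three,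
      show ((1 + τ) / 2 + τ / 2 : ℂ) = 1 / 2 + τ by ring, theta1_add_tau]
    congr 1
    rw [eq_comm]
    refine exp_eq_neg_exp ?_
    ring
  have he : exp (Real.pi * I * τ / 4) ^ 4 *
      (exp (2 * Real.pi * I * halfPeriod τ 2 * (1 / 2)) * exp (-(Real.pi * I * τ))) ^ 2 = -1 := by
    rw [← exp_add, ← exp_nat_mul, ← exp_nat_mul, ← exp_add, halfPeriod_two]
    exact (congrArg exp (by push_cast; ring)).trans exp_pi_mul_I
  rw [wp_halfPeriod_sub (by decide) (by decide), varphi₀_eq,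
    kronecker, hs, dHalfPeriod_three, cConst_one, cConst_two, cConst_three]
  generalize exp (2 * Real.pi * I * halfPeriod τ 2 * (1 / 2)) = x at *
  generalize exp (-(Real.pi * I * τ)) = y at *
  generalize exp (Real.pi * I * τ / 4) = w at *
  field_simp
  linear_combination -theta1 τ (halfPeriod τ 1) ^ 2 * he

theorem cConst_mul_three_one (τ : ℍ) :
    cConst τ 3 * cConst τ 1 * (wp τ (halfPeriod τ 3) - wp τ (halfPeriod τ 1)) =
      -I * cConst τ 2 := by
  have hK := theta1Deriv0_ne_zero τ
  have h1 := theta1_ne_zero (halfPeriod_notMem τ (k := 1) (by decide))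
  have h3 := theta1_ne_zero (halfPeriod_notMem τ (k := 3) (by decide))
  have hs : halfPeriod τ 3 + halfPeriod τ 1 = halfPeriod τ 2 := by
    rw [halfPeriod_one, halfPeriod_two, halfPeriod_three]
    ring
  rw [wp_halfPeriod_sub (by decide) (by decide), varphi₀_eq, kronecker, hs, dHalfPeriod_one,
    mul_zero, exp_zero, cConst_one, cConst_two, cConst_three]
  field_simp
  rw [I_sq, neg_one_mul]

theorem eps_sq {α β γ : Fin 4} (hα : α ≠ 0) (hβ : β ≠ 0) (hγ : γ ≠ 0) (hαβ : α ≠ β)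
    (hβγ : β ≠ γ) (hαγ : α ≠ γ) : eps α β γ ^ 2 = 1 := by
  have h : ((α, β, γ) ∈ ({(1, 2, 3), (2, 3, 1), (3, 1, 2)} : Finset (Fin 4 × Fin 4 × Fin 4))) ∨
      ((α, β, γ) ∈ ({(1, 3, 2), (3, 2, 1), (2, 1, 3)} : Finset (Fin 4 × Fin 4 × Fin 4))) := by
    revert α β γ
    decide
  rw [eps]
  split_ifs with h1 h2
  · norm_num
  · norm_num
  · tauto

theorem eps_rotate (α β γ : Fin 4) : eps β γ α = eps α β γ := by
  have h1 : ((β, γ, α) ∈ ({(1, 2, 3), (2, 3, 1), (3, 1, 2)} : Finset (Fin 4 × Fin 4 × Fin 4))) ↔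
      ((α, β, γ) ∈ ({(1, 2, 3), (2, 3, 1), (3, 1, 2)} : Finset (Fin 4 × Fin 4 × Fin 4))) := by
    revert α β γ
    decide
  have h2 : ((β, γ, α) ∈ ({(1, 3, 2), (3, 2, 1), (2, 1, 3)} : Finset (Fin 4 × Fin 4 × Fin 4))) ↔
      ((α, β, γ) ∈ ({(1, 3, 2), (3, 2, 1), (2, 1, 3)} : Finset (Fin 4 × Fin 4 × Fin 4))) := by
    revert α β γ
    decide
  simp only [eps, h1, h2]

theorem distinct_cases {α β γ : Fin 4} (hα : α ≠ 0) (hβ : β ≠ 0) (hγ : γ ≠ 0) (hαβ : α ≠ β)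
    (hβγ : β ≠ γ) (hαγ : α ≠ γ) :
    (α = 1 ∧ β = 2 ∧ γ = 3) ∨ (α = 2 ∧ β = 3 ∧ γ = 1) ∨ (α = 3 ∧ β = 1 ∧ γ = 2) ∨
      (α = 2 ∧ β = 1 ∧ γ = 3) ∨ (α = 3 ∧ β = 2 ∧ γ = 1) ∨ (α = 1 ∧ β = 3 ∧ γ = 2) := by
  have h : (α, β, γ) ∈ ({(1, 2, 3), (2, 3, 1), (3, 1, 2), (2, 1, 3), (3, 2, 1), (1, 3, 2)} :
      Finset (Fin 4 × Fin 4 × Fin 4)) := by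
    revert α β γ
    decide
  simpa only [Finset.mem_insert, Finset.mem_singleton, Prod.mk.injEq] using h

theorem cConst_mul (τ : ℍ) {α β γ : Fin 4} (hα : α ≠ 0) (hβ : β ≠ 0) (hγ : γ ≠ 0) (hαβ : α ≠ β)
    (hβγ : β ≠ γ) (hαγ : α ≠ γ) :
    cConst τ α * cConst τ β * (wp τ (halfPeriod τ α) - wp τ (halfPeriod τ β)) =
      -I * eps α β γ * cConst τ γ := by
  have e1 : eps 1 2 3 = 1 := if_pos (by decide)
  have e2 : eps 2 3 1 = 1 := if_pos (by decide)
  have e3 : eps 3 1 2 = 1 := if_pos (by decide)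
  have e4 : eps 2 1 3 = -1 := (if_neg (by decide)).trans (if_pos (by decide))
  have e5 : eps 3 2 1 = -1 := (if_neg (by decide)).trans (if_pos (by decide))
  have e6 : eps 1 3 2 = -1 := (if_neg (by decide)).trans (if_pos (by decide))
  have h1 := cConst_mul_one_two τ
  have h2 := cConst_mul_two_three τ
  have h3 := cConst_mul_three_one τ
  rcases distinct_cases hα hβ hγ hαβ hβγ hαγ with ⟨rfl, rfl, rfl⟩ | ⟨rfl, rfl, rfl⟩ |
    ⟨rfl, rfl, rfl⟩ | ⟨rfl, rfl, rfl⟩ | ⟨rfl, rfl, rfl⟩ | ⟨rfl, rfl, rfl⟩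
  · rw [e1, mul_one]; exact h1
  · rw [e2, mul_one]; exact h2
  · rw [e3, mul_one]; exact h3
  · rw [e4]; linear_combination -h1
  · rw [e5]; linear_combination -h2
  · rw [e6]; linear_combination -h3

theorem varphi₀_prod (τ : ℍ) {α β γ : Fin 4} (hα : α ≠ 0) (hβ : β ≠ 0) (hγ : γ ≠ 0)
    (hαβ : α ≠ β) (hβγ : β ≠ γ) (hαγ : α ≠ γ) (z : ℂ) :
    varphi₀ τ 1 z * varphi₀ τ 2 z * varphi₀ τ 3 z =
      varphi₀ τ α z * varphi₀ τ β z * varphi₀ τ γ z := by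
  rcases distinct_cases hα hβ hγ hαβ hβγ hαγ with ⟨rfl, rfl, rfl⟩ | ⟨rfl, rfl, rfl⟩ |
    ⟨rfl, rfl, rfl⟩ | ⟨rfl, rfl, rfl⟩ | ⟨rfl, rfl, rfl⟩ | ⟨rfl, rfl, rfl⟩ <;> ring

theorem deriv_varphi₀ {τ : ℍ} {α β γ : Fin 4} (hα : α ≠ 0) (hβ : β ≠ 0) (hγ : γ ≠ 0)
    (hαβ : α ≠ β) (hβγ : β ≠ γ) (hαγ : α ≠ γ) {z : ℂ} (hz : z ∉ (periods τ).lattice) :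
    deriv (varphi₀ τ α) z = -(varphi₀ τ β z * varphi₀ τ γ z) :=
  deriv_varphi₀_of_prod hα hβ hγ (varphi₀_prod τ hα hβ hγ hαβ hβγ hαγ) hz

/-! ### The product `v̆(q, η) v̆(-q, η)` -/

theorem varphi_symm_zero_of_distinct {τ : ℍ} {z u : ℂ} (hz : z ∉ (periods τ).lattice)
    (hu : 2 * u ∉ (periods τ).lattice) {α β γ : Fin 4} (hα : α ≠ 0) (hβ : β ≠ 0)
    (hγ : γ ≠ 0) (hαβ : α ≠ β) (hβγ : β ≠ γ) (hαγ : α ≠ γ) :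
    varphi τ 0 z u * varphi τ α (-z) u + varphi τ α z u * varphi τ 0 (-z) u =
      -2 * (varphi₀ τ β z * varphi₀ τ γ z) :=
  varphi_symm_zero hα hβ hγ (varphi₀_prod τ hα hβ hγ hαβ hβγ hαγ) hz
    (by simpa [halfPeriod_zero] using add_halfPeriod_notMem hu 0) (add_halfPeriod_notMem hu α)

theorem two_mul_add_halfPeriod_notMem {τ : ℍ} {u : ℂ} (hu : 2 * u ∉ (periods τ).lattice)
    (a : Fin 4) : 2 * (u + halfPeriod τ a) ∉ (periods τ).lattice := by
  rwa [mul_add, Submodule.add_mem_iff_left _ (two_mul_halfPeriod_mem τ a)]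

/-- The relation for `φ_α`, `φ_β` is the one for `φ₀`, `φ_γ` with `u` shifted by a half-period. -/
theorem varphi_symm_one_two {τ : ℍ} {z u : ℂ} (hz : z ∉ (periods τ).lattice)
    (hu : 2 * u ∉ (periods τ).lattice) :
    varphi τ 1 z u * varphi τ 2 (-z) u + varphi τ 2 z u * varphi τ 1 (-z) u =
      -2 * (varphi₀ τ 1 z * varphi₀ τ 2 z) := by
  have h := varphi_symm_zero_of_distinct (α := 3) (β := 1) (γ := 2) hz
    (two_mul_add_halfPeriod_notMem hu 1) (by decide) (by decide) (by decide) (by decide)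
    (by decide) (by decide)
  rwa [varphi_zero_add_one_half, varphi_zero_add_one_half, varphi_three_add_one_half,
    varphi_three_add_one_half] at h

theorem varphi_symm_one_three {τ : ℍ} {z u : ℂ} (hz : z ∉ (periods τ).lattice)
    (hu : 2 * u ∉ (periods τ).lattice) :
    varphi τ 1 z u * varphi τ 3 (-z) u + varphi τ 3 z u * varphi τ 1 (-z) u =
      -2 * (varphi₀ τ 1 z * varphi₀ τ 3 z) := by
  have h := varphi_symm_zero_of_distinct (α := 2) (β := 1) (γ := 3) hz
    (two_mul_add_halfPeriod_notMem hu 1) (by decide) (by decide) (by decide) (by decide)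
    (by decide) (by decide)
  rwa [varphi_zero_add_one_half, varphi_zero_add_one_half, varphi_two_add_one_half,
    varphi_two_add_one_half] at h

theorem varphi_symm_two_three {τ : ℍ} {z u : ℂ} (hz : z ∉ (periods τ).lattice)
    (hu : 2 * u ∉ (periods τ).lattice) :
    varphi τ 2 z u * varphi τ 3 (-z) u + varphi τ 3 z u * varphi τ 2 (-z) u =
      -2 * (varphi₀ τ 2 z * varphi₀ τ 3 z) := by
  have h := varphi_symm_zero_of_distinct (α := 1) (β := 2) (γ := 3) hz
    (two_mul_add_halfPeriod_notMem hu 2) (by decide) (by decide) (by decide) (by decide)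
    (by decide) (by decide)
  rw [varphi_zero_add_halfPeriod_two, varphi_zero_add_halfPeriod_two,
    varphi_one_add_halfPeriod_two, varphi_one_add_halfPeriod_two] at h
  have he := exp_mul_exp_neg_mul (-z) (1 / 2)
  linear_combination h - (varphi τ 2 z u * varphi τ 3 (-z) u +
    varphi τ 3 z u * varphi τ 2 (-z) u) * he

theorem v_mul_v_neg {τ : ℍ} {q η : ℂ} (hq : 2 * q ∉ (periods τ).lattice)
    (hη : 2 * η ∉ (periods τ).lattice) (b : Fin 4 → ℂ) :
    v τ b q η * v τ b (-q) η =
      ∑ a, b a ^ 2 * wp τ (η + halfPeriod τ a) - (∑ a, b a ^ 2) * wp τ (2 * q) -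
        2 * b 0 * (b 1 * (varphi₀ τ 2 (2 * q) * varphi₀ τ 3 (2 * q)) +
          b 2 * (varphi₀ τ 1 (2 * q) * varphi₀ τ 3 (2 * q)) +
          b 3 * (varphi₀ τ 1 (2 * q) * varphi₀ τ 2 (2 * q))) -
        2 * (b 1 * b 2 * (varphi₀ τ 1 (2 * q) * varphi₀ τ 2 (2 * q)) +
          b 1 * b 3 * (varphi₀ τ 1 (2 * q) * varphi₀ τ 3 (2 * q)) +
          b 2 * b 3 * (varphi₀ τ 2 (2 * q) * varphi₀ τ 3 (2 * q))) := by
  have hd := fun a => varphi_mul_neg a hq (add_halfPeriod_notMem hη a)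
  have h01 := varphi_symm_zero_of_distinct (α := 1) (β := 2) (γ := 3) hq hη (by decide)
    (by decide) (by decide) (by decide) (by decide) (by decide)
  have h02 := varphi_symm_zero_of_distinct (α := 2) (β := 1) (γ := 3) hq hη (by decide)
    (by decide) (by decide) (by decide) (by decide) (by decide)
  have h03 := varphi_symm_zero_of_distinct (α := 3) (β := 1) (γ := 2) hq hη (by decide)
    (by decide) (by decide) (by decide) (by decide) (by decide)
  have h12 := varphi_symm_one_two hq hη
  have h13 := varphi_symm_one_three hq hη
  have h23 := varphi_symm_two_three hq hη
  simp only [v, Fin.sum_univ_four, mul_neg]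
  linear_combination b 0 ^ 2 * hd 0 + b 1 ^ 2 * hd 1 + b 2 ^ 2 * hd 2 + b 3 ^ 2 * hd 3 +
    b 0 * b 1 * h01 + b 0 * b 2 * h02 + b 0 * b 3 * h03 + b 1 * b 2 * h12 + b 1 * b 3 * h13 +
    b 2 * b 3 * h23

theorem v_mul_v_neg_of_distinct {τ : ℍ} {q η : ℂ} (hq : 2 * q ∉ (periods τ).lattice)
    (hη : 2 * η ∉ (periods τ).lattice) (b : Fin 4 → ℂ) {α β γ : Fin 4} (hα : α ≠ 0) (hβ : β ≠ 0)
    (hγ : γ ≠ 0) (hαβ : α ≠ β) (hβγ : β ≠ γ) (hαγ : α ≠ γ) :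
    v τ b q η * v τ b (-q) η =
      ∑ a, b a ^ 2 * wp τ (η + halfPeriod τ a) -
        (b 0 ^ 2 + b α ^ 2 + b β ^ 2 + b γ ^ 2) * wp τ (2 * q) -
        2 * b 0 * (b α * (varphi₀ τ β (2 * q) * varphi₀ τ γ (2 * q)) +
          b β * (varphi₀ τ α (2 * q) * varphi₀ τ γ (2 * q)) +
          b γ * (varphi₀ τ α (2 * q) * varphi₀ τ β (2 * q))) -
        2 * (b α * b β * (varphi₀ τ α (2 * q) * varphi₀ τ β (2 * q)) +
          b α * b γ * (varphi₀ τ α (2 * q) * varphi₀ τ γ (2 * q)) +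
          b β * b γ * (varphi₀ τ β (2 * q) * varphi₀ τ γ (2 * q))) := by
  rw [v_mul_v_neg hq hη, Fin.sum_univ_four (fun a => b a ^ 2)]
  rcases distinct_cases hα hβ hγ hαβ hβγ hαγ with ⟨rfl, rfl, rfl⟩ | ⟨rfl, rfl, rfl⟩ |
    ⟨rfl, rfl, rfl⟩ | ⟨rfl, rfl, rfl⟩ | ⟨rfl, rfl, rfl⟩ | ⟨rfl, rfl, rfl⟩ <;> ring

/-! ### The functions `S` and their derivatives -/

theorem S_zero (τ : ℍ) (c η : ℂ) (ν : Fin 4 → ℂ) (p q : ℂ) : S τ c η ν 0 p q =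
    1 / 2 * (v τ (dual ν) q η * exp (p / (2 * c)) + v τ (dual ν) (-q) η * exp (-p / (2 * c))) :=
  if_pos rfl

theorem S_of_distinct (τ : ℍ) (c η : ℂ) (ν : Fin 4 → ℂ) (p q : ℂ) {α β γ : Fin 4} (hα : α ≠ 0)
    (hβ : β ≠ 0) (hγ : γ ≠ 0) (hαβ : α ≠ β) (hβγ : β ≠ γ) (hαγ : α ≠ γ) :
    S τ c η ν α p q = cConst τ α *
      (varphi₀ τ α (2 * q) * ((v τ (dual ν) q η * exp (p / (2 * c)) -
          v τ (dual ν) (-q) η * exp (-p / (2 * c))) / 2 +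
        (dual ν α * varphi₀ τ α (2 * q) + dual ν β * varphi₀ τ β (2 * q) +
          dual ν γ * varphi₀ τ γ (2 * q))) +
        dual ν 0 * (varphi₀ τ β (2 * q) * varphi₀ τ γ (2 * q))) := by
  have h1 : ({1, 2, 3} : Finset (Fin 4)) = {α, β, γ} := by
    revert α β γ
    decide
  have h2 : ({1, 2, 3} : Finset (Fin 4)).erase α = {β, γ} := by
    revert α β γ
    decide
  rw [S, if_neg hα, h2, h1, Finset.prod_pair hβγ, Finset.sum_insert (by simp [hαβ, hαγ]),
    Finset.sum_pair hβγ, vDual, vDual]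
  ring

theorem differentiableAt_v {τ : ℍ} {q η : ℂ} (hq : 2 * q ∉ (periods τ).lattice)
    (hη : 2 * η ∉ (periods τ).lattice) (b : Fin 4 → ℂ) :
    DifferentiableAt ℂ (fun q => v τ b q η) q := by
  unfold v
  refine DifferentiableAt.fun_sum fun a _ => DifferentiableAt.const_mul ?_ _
  exact DifferentiableAt.comp q (f := fun q : ℂ => 2 * q)
    (differentiableAt_varphi a hq (add_halfPeriod_notMem hη a)) (by fun_prop)

theorem differentiableAt_v_neg {τ : ℍ} {q η : ℂ} (hq : 2 * q ∉ (periods τ).lattice)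
    (hη : 2 * η ∉ (periods τ).lattice) (b : Fin 4 → ℂ) :
    DifferentiableAt ℂ (fun q => v τ b (-q) η) q := by
  refine DifferentiableAt.comp q (f := fun q : ℂ => -q) (g := fun q => v τ b q η)
    (differentiableAt_v ?_ hη b) (by fun_prop)
  rw [mul_neg]
  exact neg_notMem hq

theorem hasDerivAt_varphi₀_two_mul {τ : ℍ} {q : ℂ} (hq : 2 * q ∉ (periods τ).lattice)
    {α β γ : Fin 4} (hα : α ≠ 0) (hβ : β ≠ 0) (hγ : γ ≠ 0) (hαβ : α ≠ β) (hβγ : β ≠ γ)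
    (hαγ : α ≠ γ) : HasDerivAt (fun y => varphi₀ τ α (2 * y))
      (-2 * (varphi₀ τ β (2 * q) * varphi₀ τ γ (2 * q))) q := by
  have h1 := (differentiableAt_varphi₀ hα hq).hasDerivAt
  rw [deriv_varphi₀ hα hβ hγ hαβ hβγ hαγ hq] at h1
  have h2 := HasDerivAt.comp q h1 ((hasDerivAt_id q).const_mul 2)
  exact h2.congr_deriv (by simp only [mul_one]; ring)

theorem hasDerivAt_exp_div (c p : ℂ) :
    HasDerivAt (fun x => exp (x / (2 * c))) (exp (p / (2 * c)) / (2 * c)) p := by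
  have h := ((hasDerivAt_id p).div_const (2 * c)).cexp
  exact h.congr_deriv (by simp only [id]; ring)

theorem hasDerivAt_exp_neg_div (c p : ℂ) :
    HasDerivAt (fun x => exp (-x / (2 * c))) (-exp (-p / (2 * c)) / (2 * c)) p := by
  have h := ((hasDerivAt_id p).fun_neg.div_const (2 * c)).cexp
  exact h.congr_deriv (by simp only [id]; ring)

/-- The derivative of the product `v̆(q, η) v̆(-q, η)`, which is the only information about the
derivative of `v̆` that enters the brackets `{S₀, S_α}`. -/
theorem deriv_v_mul_v_neg {τ : ℍ} {q η : ℂ} (hq : 2 * q ∉ (periods τ).lattice)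
    (hη : 2 * η ∉ (periods τ).lattice) (b : Fin 4 → ℂ) {α β γ : Fin 4} (hα : α ≠ 0) (hβ : β ≠ 0)
    (hγ : γ ≠ 0) (hαβ : α ≠ β) (hβγ : β ≠ γ) (hαγ : α ≠ γ) :
    deriv (fun q => v τ b q η) q * v τ b (-q) η + v τ b q η * deriv (fun q => v τ b (-q) η) q =
      4 * (b 0 ^ 2 + b α ^ 2 + b β ^ 2 + b γ ^ 2) *
          (varphi₀ τ α (2 * q) * varphi₀ τ β (2 * q) * varphi₀ τ γ (2 * q)) +
        4 * (b 0 * b α + b β * b γ) *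
          (varphi₀ τ α (2 * q) * (varphi₀ τ β (2 * q) ^ 2 + varphi₀ τ γ (2 * q) ^ 2)) +
        4 * (b 0 * b β + b α * b γ) *
          (varphi₀ τ β (2 * q) * (varphi₀ τ α (2 * q) ^ 2 + varphi₀ τ γ (2 * q) ^ 2)) +
        4 * (b 0 * b γ + b α * b β) *
          (varphi₀ τ γ (2 * q) * (varphi₀ τ α (2 * q) ^ 2 + varphi₀ τ β (2 * q) ^ 2)) := by
  have hl := (differentiableAt_v hq hη b).hasDerivAt.fun_mul
    (differentiableAt_v_neg hq hη b).hasDerivAt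
  have hfα := hasDerivAt_varphi₀_two_mul hq hα hβ hγ hαβ hβγ hαγ
  have hfβ := hasDerivAt_varphi₀_two_mul hq hβ hγ hα hβγ hαγ.symm hαβ.symm
  have hfγ := hasDerivAt_varphi₀_two_mul hq hγ hα hβ hαγ.symm hαβ hβγ.symm
  have hP : HasDerivAt (fun y => wp τ (2 * y)) (-4 * (varphi₀ τ α (2 * q) *
      varphi₀ τ β (2 * q) * varphi₀ τ γ (2 * q))) q := by
    have h1 := HasDerivAt.comp q (differentiableAt_wp hq).hasDerivAt
      ((hasDerivAt_id q).const_mul 2)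
    refine h1.congr_deriv ?_
    rw [deriv_wp_eq hq, varphi₀_prod τ hα hβ hγ hαβ hβγ hαγ]
    ring
  have hr := (((hP.const_mul (b 0 ^ 2 + b α ^ 2 + b β ^ 2 + b γ ^ 2)).const_sub
    (∑ a, b a ^ 2 * wp τ (η + halfPeriod τ a))).fun_sub
      ((((hfβ.fun_mul hfγ).const_mul (b α)).fun_add ((hfα.fun_mul hfγ).const_mul (b β))).fun_add
        ((hfα.fun_mul hfβ).const_mul (b γ)) |>.const_mul (2 * b 0))).fun_sub
      ((((hfα.fun_mul hfβ).const_mul (b α * b β)).fun_add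
        ((hfα.fun_mul hfγ).const_mul (b α * b γ))).fun_add
        ((hfβ.fun_mul hfγ).const_mul (b β * b γ)) |>.const_mul 2)
  have hopen : {y : ℂ | 2 * y ∉ (periods τ).lattice} ∈ nhds q := by
    have hc : Continuous fun y : ℂ => 2 * y := by fun_prop
    exact ((isOpen_compl_lattice τ).preimage hc).mem_nhds hq
  have heq := Filter.eventually_of_mem hopen fun y hy =>
    v_mul_v_neg_of_distinct hy hη b hα hβ hγ hαβ hβγ hαγ
  have h := hl.unique (hr.congr_of_eventuallyEq heq)
  rw [h]
  ring

theorem hasDerivAt_S_zero_fst (τ : ℍ) (c η : ℂ) (ν : Fin 4 → ℂ) (p q : ℂ) :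
    HasDerivAt (fun x => S τ c η ν 0 x q)
      ((v τ (dual ν) q η * exp (p / (2 * c)) -
        v τ (dual ν) (-q) η * exp (-p / (2 * c))) / (4 * c)) p := by
  have h := (((hasDerivAt_exp_div c p).const_mul (v τ (dual ν) q η)).fun_add
    ((hasDerivAt_exp_neg_div c p).const_mul (v τ (dual ν) (-q) η))).const_mul (1 / 2)
  exact h.congr_deriv (by ring)

theorem hasDerivAt_S_zero_snd {τ : ℍ} (c : ℂ) {η : ℂ} (ν : Fin 4 → ℂ) (p : ℂ) {q : ℂ}
    (hq : 2 * q ∉ (periods τ).lattice) (hη : 2 * η ∉ (periods τ).lattice) :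
    HasDerivAt (fun y => S τ c η ν 0 p y)
      ((deriv (fun y => v τ (dual ν) y η) q * exp (p / (2 * c)) +
        deriv (fun y => v τ (dual ν) (-y) η) q * exp (-p / (2 * c))) / 2) q := by
  have h := (((differentiableAt_v hq hη (dual ν)).hasDerivAt.mul_const (exp (p / (2 * c)))).fun_add
    ((differentiableAt_v_neg hq hη (dual ν)).hasDerivAt.mul_const
      (exp (-p / (2 * c))))).const_mul (1 / 2)
  exact h.congr_deriv (by ring)

theorem hasDerivAt_S_fst (τ : ℍ) (c η : ℂ) (ν : Fin 4 → ℂ) (p q : ℂ) {α β γ : Fin 4}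
    (hα : α ≠ 0) (hβ : β ≠ 0) (hγ : γ ≠ 0) (hαβ : α ≠ β) (hβγ : β ≠ γ) (hαγ : α ≠ γ) :
    HasDerivAt (fun x => S τ c η ν α x q)
      (cConst τ α * varphi₀ τ α (2 * q) * (v τ (dual ν) q η * exp (p / (2 * c)) +
        v τ (dual ν) (-q) η * exp (-p / (2 * c))) / (4 * c)) p := by
  have h0 := ((hasDerivAt_exp_div c p).const_mul (v τ (dual ν) q η)).fun_sub
    ((hasDerivAt_exp_neg_div c p).const_mul (v τ (dual ν) (-q) η))
  have h1 := ((((h0.div_const 2).add_const (dual ν α * varphi₀ τ α (2 * q) +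
    dual ν β * varphi₀ τ β (2 * q) + dual ν γ * varphi₀ τ γ (2 * q))).const_mul
    (varphi₀ τ α (2 * q))).add_const
      (dual ν 0 * (varphi₀ τ β (2 * q) * varphi₀ τ γ (2 * q)))).const_mul (cConst τ α)
  rw [funext fun x => S_of_distinct τ c η ν x q hα hβ hγ hαβ hβγ hαγ]
  exact h1.congr_deriv (by ring)

theorem hasDerivAt_S_snd {τ : ℍ} (c : ℂ) {η : ℂ} (ν : Fin 4 → ℂ) (p : ℂ) {q : ℂ}
    (hq : 2 * q ∉ (periods τ).lattice) (hη : 2 * η ∉ (periods τ).lattice) {α β γ : Fin 4}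
    (hα : α ≠ 0) (hβ : β ≠ 0) (hγ : γ ≠ 0) (hαβ : α ≠ β) (hβγ : β ≠ γ) (hαγ : α ≠ γ) :
    HasDerivAt (fun y => S τ c η ν α p y)
      (cConst τ α *
        (-2 * (varphi₀ τ β (2 * q) * varphi₀ τ γ (2 * q)) *
          ((v τ (dual ν) q η * exp (p / (2 * c)) -
            v τ (dual ν) (-q) η * exp (-p / (2 * c))) / 2 +
          (dual ν α * varphi₀ τ α (2 * q) + dual ν β * varphi₀ τ β (2 * q) +
            dual ν γ * varphi₀ τ γ (2 * q))) +
        varphi₀ τ α (2 * q) *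
          ((deriv (fun y => v τ (dual ν) y η) q * exp (p / (2 * c)) -
            deriv (fun y => v τ (dual ν) (-y) η) q * exp (-p / (2 * c))) / 2 -
          2 * (dual ν α * (varphi₀ τ β (2 * q) * varphi₀ τ γ (2 * q)) +
            dual ν β * (varphi₀ τ α (2 * q) * varphi₀ τ γ (2 * q)) +
            dual ν γ * (varphi₀ τ α (2 * q) * varphi₀ τ β (2 * q)))) -
        2 * dual ν 0 * (varphi₀ τ α (2 * q) *
          (varphi₀ τ β (2 * q) ^ 2 + varphi₀ τ γ (2 * q) ^ 2)))) q := by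
  have hfα := hasDerivAt_varphi₀_two_mul hq hα hβ hγ hαβ hβγ hαγ
  have hfβ := hasDerivAt_varphi₀_two_mul hq hβ hγ hα hβγ hαγ.symm hαβ.symm
  have hfγ := hasDerivAt_varphi₀_two_mul hq hγ hα hβ hαγ.symm hαβ hβγ.symm
  have h0 := ((differentiableAt_v hq hη (dual ν)).hasDerivAt.mul_const (exp (p / (2 * c)))).fun_sub
    ((differentiableAt_v_neg hq hη (dual ν)).hasDerivAt.mul_const (exp (-p / (2 * c))))
  have h1 := ((hfα.fun_mul ((h0.div_const 2).fun_add (((hfα.const_mul (dual ν α)).fun_add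
    (hfβ.const_mul (dual ν β))).fun_add (hfγ.const_mul (dual ν γ))))).fun_add
    ((hfβ.fun_mul hfγ).const_mul (dual ν 0))).const_mul (cConst τ α)
  rw [funext fun y => S_of_distinct τ c η ν p y hα hβ hγ hαβ hβγ hαγ]
  exact h1.congr_deriv (by ring)

theorem differentiableAt_S {τ : ℍ} (c : ℂ) {η : ℂ} (ν : Fin 4 → ℂ) (p : ℂ) {q : ℂ}
    (hq : 2 * q ∉ (periods τ).lattice) (hη : 2 * η ∉ (periods τ).lattice) (a : Fin 4) :
    DifferentiableAt ℂ (fun x : ℂ × ℂ => S τ c η ν a x.1 x.2) (p, q) := by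
  have hv : DifferentiableAt ℂ (fun x : ℂ × ℂ => v τ (dual ν) x.2 η) (p, q) :=
    DifferentiableAt.comp (p, q) (g := fun y => v τ (dual ν) y η) (f := fun x : ℂ × ℂ => x.2)
      (differentiableAt_v hq hη (dual ν)) (by fun_prop)
  have hv' : DifferentiableAt ℂ (fun x : ℂ × ℂ => v τ (dual ν) (-x.2) η) (p, q) :=
    DifferentiableAt.comp (p, q) (g := fun y => v τ (dual ν) (-y) η) (f := fun x : ℂ × ℂ => x.2)
      (differentiableAt_v_neg hq hη (dual ν)) (by fun_prop)
  have hf : ∀ k : Fin 4, k ≠ 0 →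
      DifferentiableAt ℂ (fun x : ℂ × ℂ => varphi₀ τ k (2 * x.2)) (p, q) := fun k hk =>
    DifferentiableAt.comp (p, q) (g := varphi₀ τ k) (f := fun x : ℂ × ℂ => 2 * x.2)
      (differentiableAt_varphi₀ hk hq) (by fun_prop)
  have he : DifferentiableAt ℂ (fun x : ℂ × ℂ => exp (x.1 / (2 * c))) (p, q) := by fun_prop
  have he' : DifferentiableAt ℂ (fun x : ℂ × ℂ => exp (-x.1 / (2 * c))) (p, q) := by fun_prop
  by_cases ha : a = 0
  · subst ha
    simp only [S_zero]
    fun_prop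
  · obtain ⟨β, γ, hβ, hγ, h1, h2, h3⟩ : ∃ β γ : Fin 4, β ≠ 0 ∧ γ ≠ 0 ∧ a ≠ β ∧ β ≠ γ ∧ a ≠ γ := by
      revert a
      decide
    have hfa := hf a ha
    have hfβ := hf β hβ
    have hfγ := hf γ hγ
    simp only [fun x : ℂ × ℂ => S_of_distinct τ c η ν x.1 x.2 ha hβ hγ h1 h2 h3]
    fun_prop

/-! ### The brackets and the Casimir functions -/

theorem exp_div_mul_exp_neg_div (c p : ℂ) : exp (p / (2 * c)) * exp (-p / (2 * c)) = 1 := by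
  rw [← exp_add, neg_div, add_neg_cancel, exp_zero]

/-- The terms with derivatives of `v̆` cancel: with `T_α = S_α / c_α`, the left-hand side equals
`c_α c_β (φ_β² - φ_α²) S₀ T_γ`. -/
theorem bracket_S_S {τ : ℍ} {c : ℂ} (hc : c ≠ 0) {η : ℂ} (ν : Fin 4 → ℂ) (p : ℂ) {q : ℂ}
    (hq : 2 * q ∉ (periods τ).lattice) (hη : 2 * η ∉ (periods τ).lattice) {α β γ : Fin 4}
    (hα : α ≠ 0) (hβ : β ≠ 0) (hγ : γ ≠ 0) (hαβ : α ≠ β) (hβγ : β ≠ γ) (hαγ : α ≠ γ) :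
    c * canonicalBracket (S τ c η ν α) (S τ c η ν β) p q =
      -I * eps α β γ * S τ c η ν 0 p q * S τ c η ν γ p q := by
  have hC := cConst_mul τ hα hβ hγ hαβ hβγ hαγ
  rw [show wp τ (halfPeriod τ α) - wp τ (halfPeriod τ β) =
    varphi₀ τ β (2 * q) ^ 2 - varphi₀ τ α (2 * q) ^ 2 by
      rw [varphi₀_sq hα hq, varphi₀_sq hβ hq]; ring] at hC
  rw [canonicalBracket, (hasDerivAt_S_fst τ c η ν p q hα hβ hγ hαβ hβγ hαγ).deriv,
    (hasDerivAt_S_fst τ c η ν p q hβ hγ hα hβγ hαγ.symm hαβ.symm).deriv,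
    (hasDerivAt_S_snd c ν p hq hη hα hβ hγ hαβ hβγ hαγ).deriv,
    (hasDerivAt_S_snd c ν p hq hη hβ hγ hα hβγ hαγ.symm hαβ.symm).deriv, S_zero,
    S_of_distinct τ c η ν p q hγ hα hβ hαγ.symm hαβ hβγ.symm]
  generalize varphi₀ τ α (2 * q) = fα at *
  generalize varphi₀ τ β (2 * q) = fβ at *
  generalize varphi₀ τ γ (2 * q) = fγ at *
  generalize exp (p / (2 * c)) = E at *
  generalize exp (-p / (2 * c)) = F at *
  generalize v τ (dual ν) q η = A at *
  generalize v τ (dual ν) (-q) η = B at *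
  field_simp
  linear_combination (8 * (A * E + B * F) * (fγ * ((A * E - B * F) / 2 +
    (dual ν γ * fγ + dual ν α * fα + dual ν β * fβ)) + dual ν 0 * (fα * fβ))) * hC

/-- Since `e^{p/2c} e^{-p/2c} = 1`, the derivatives of `v̆` enter only through the derivative of
`v̆(q, η) v̆(-q, η)`. The right-hand side is `c_α` times a polynomial in `T_β = S_β / c_β`,
`T_γ = S_γ / c_γ` and the `φ_k`, by the quadratic relations between the `c_k`. -/
theorem bracket_S_zero_S {τ : ℍ} {c : ℂ} (hc : c ≠ 0) {η : ℂ} (ν : Fin 4 → ℂ) (p : ℂ) {q : ℂ}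
    (hq : 2 * q ∉ (periods τ).lattice) (hη : 2 * η ∉ (periods τ).lattice) {α β γ : Fin 4}
    (hα : α ≠ 0) (hβ : β ≠ 0) (hγ : γ ≠ 0) (hαβ : α ≠ β) (hβγ : β ≠ γ) (hαγ : α ≠ γ) :
    c * canonicalBracket (S τ c η ν 0) (S τ c η ν α) p q =
      -I * eps α β γ * S τ c η ν β p q * S τ c η ν γ p q *
          (wp τ (halfPeriod τ β) - wp τ (halfPeriod τ γ)) +
        I * eps α β γ * (S τ c η ν β p q * lam τ ν γ - lam τ ν β * S τ c η ν γ p q) := by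
  have hε := eps_sq hα hβ hγ hαβ hβγ hαγ
  have h1 := cConst_mul τ hα hβ hγ hαβ hβγ hαγ
  have h2 := cConst_mul τ hβ hγ hα hβγ hαγ.symm hαβ.symm
  have h3 := cConst_mul τ hγ hα hβ hαγ.symm hαβ hβγ.symm
  rw [eps_rotate] at h2
  rw [eps_rotate β γ α, eps_rotate α β γ] at h3
  have hlβ : cConst τ β * lam τ ν β = dual ν β := mul_div_cancel₀ _ (cConst_ne_zero τ hβ)
  have hlγ : cConst τ γ * lam τ ν γ = dual ν γ := mul_div_cancel₀ _ (cConst_ne_zero τ hγ)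
  have hAB := deriv_v_mul_v_neg hq hη (dual ν) hα hβ hγ hαβ hβγ hαγ
  have hEF := exp_div_mul_exp_neg_div c p
  have hI := I_sq
  have heαβ : wp τ (halfPeriod τ α) - wp τ (halfPeriod τ β) =
      varphi₀ τ β (2 * q) ^ 2 - varphi₀ τ α (2 * q) ^ 2 := by
    rw [varphi₀_sq hα hq, varphi₀_sq hβ hq]; ring
  have heγα : wp τ (halfPeriod τ γ) - wp τ (halfPeriod τ α) =
      varphi₀ τ α (2 * q) ^ 2 - varphi₀ τ γ (2 * q) ^ 2 := by
    rw [varphi₀_sq hα hq, varphi₀_sq hγ hq]; ring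
  rw [heαβ] at h1
  rw [heγα] at h3
  rw [canonicalBracket, (hasDerivAt_S_zero_fst τ c η ν p q).deriv,
    (hasDerivAt_S_fst τ c η ν p q hα hβ hγ hαβ hβγ hαγ).deriv,
    (hasDerivAt_S_snd c ν p hq hη hα hβ hγ hαβ hβγ hαγ).deriv,
    (hasDerivAt_S_zero_snd c ν p hq hη).deriv,
    S_of_distinct τ c η ν p q hβ hγ hα hβγ hαγ.symm hαβ.symm,
    S_of_distinct τ c η ν p q hγ hα hβ hαγ.symm hαβ hβγ.symm]
  generalize varphi₀ τ α (2 * q) = fα at *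
  generalize varphi₀ τ β (2 * q) = fβ at *
  generalize varphi₀ τ γ (2 * q) = fγ at *
  generalize exp (p / (2 * c)) = E at *
  generalize exp (-p / (2 * c)) = F at *
  generalize deriv (fun y => v τ (dual ν) y η) q = A' at *
  generalize deriv (fun y => v τ (dual ν) (-y) η) q = B' at *
  generalize v τ (dual ν) q η = A at *
  generalize v τ (dual ν) (-q) η = B at *
  generalize dual ν 0 = b0 at *
  generalize dual ν α = bα at *
  generalize dual ν β = bβ at *
  generalize dual ν γ = bγ at *
  generalize lam τ ν β = lβ at *
  generalize lam τ ν γ = lγ at *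
  generalize cConst τ α = cα at *
  generalize cConst τ β = cβ at *
  generalize cConst τ γ = cγ at *
  generalize wp τ (halfPeriod τ β) - wp τ (halfPeriod τ γ) = eβγ at *
  generalize eps α β γ = ε at *
  obtain ⟨Tβ, hTβ⟩ : ∃ T, T = fβ * ((A * E - B * F) / 2 + (bβ * fβ + bγ * fγ + bα * fα)) +
    b0 * (fγ * fα) := ⟨_, rfl⟩
  obtain ⟨Tγ, hTγ⟩ : ∃ T, T = fγ * ((A * E - B * F) / 2 + (bγ * fγ + bα * fα + bβ * fβ)) +
    b0 * (fα * fβ) := ⟨_, rfl⟩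
  have hr : -I * ε * (cβ * Tβ) * (cγ * Tγ) * eβγ + I * ε * (cβ * Tβ * lγ - lβ * (cγ * Tγ)) =
      cα * (-(Tβ * Tγ) - bγ * Tβ * (fα ^ 2 - fγ ^ 2) + bβ * Tγ * (fβ ^ 2 - fα ^ 2)) := by
    linear_combination (-I * ε * Tβ * Tγ) * h2 + cα * Tβ * Tγ * ε ^ 2 * hI -
      cα * Tβ * Tγ * hε + Tβ * lγ * h3 - cα * Tβ * (fα ^ 2 - fγ ^ 2) * hlγ - lβ * Tγ * h1 +
      cα * Tγ * (fβ ^ 2 - fα ^ 2) * hlβ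
  rw [← hTβ, ← hTγ, hr, hTβ, hTγ]
  field_simp
  linear_combination (-4 * cα * fα) * hAB - 4 * cα * fα * (A' * B + A * B') * hEF

/-- The `c_k²` are the Lagrange interpolation weights of the nodes `℘(ω_k)`. -/
theorem cConst_sq_mul (τ : ℍ) {α β γ : Fin 4} (hα : α ≠ 0) (hβ : β ≠ 0) (hγ : γ ≠ 0)
    (hαβ : α ≠ β) (hβγ : β ≠ γ) (hαγ : α ≠ γ) :
    cConst τ α ^ 2 * ((wp τ (halfPeriod τ α) - wp τ (halfPeriod τ β)) *
      (wp τ (halfPeriod τ α) - wp τ (halfPeriod τ γ))) = 1 := by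
  have hε := eps_sq hα hβ hγ hαβ hβγ hαγ
  have h1 := cConst_mul τ hα hβ hγ hαβ hβγ hαγ
  have h3 := cConst_mul τ hγ hα hβ hαγ.symm hαβ hβγ.symm
  rw [eps_rotate β γ α, eps_rotate α β γ] at h3
  refine mul_left_cancel₀ (mul_ne_zero (cConst_ne_zero τ hβ) (cConst_ne_zero τ hγ)) ?_
  linear_combination (-cConst τ γ * cConst τ α * (wp τ (halfPeriod τ γ) -
    wp τ (halfPeriod τ α))) * h1 + I * eps α β γ * cConst τ γ * h3 -
    eps α β γ ^ 2 * cConst τ β * cConst τ γ * I_sq + cConst τ β * cConst τ γ * hε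

/-- Lagrange interpolation at three distinct nodes, with weights `x_i = ∏_{j ≠ i} (e_i - e_j)⁻¹`. -/
theorem lagrange_weights {x₁ x₂ x₃ e₁ e₂ e₃ : ℂ} (h₁ : x₁ * ((e₁ - e₂) * (e₁ - e₃)) = 1)
    (h₂ : x₂ * ((e₂ - e₃) * (e₂ - e₁)) = 1) (h₃ : x₃ * ((e₃ - e₁) * (e₃ - e₂)) = 1) :
    x₁ + x₂ + x₃ = 0 ∧ x₁ * e₁ + x₂ * e₂ + x₃ * e₃ = 0 ∧
      x₁ * e₁ ^ 2 + x₂ * e₂ ^ 2 + x₃ * e₃ ^ 2 = 1 := by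
  have h12 : e₁ - e₂ ≠ 0 := fun h => by simp [h] at h₁
  have h13 : e₁ - e₃ ≠ 0 := fun h => by simp [h] at h₁
  have h23 : e₂ - e₃ ≠ 0 := fun h => by simp [h] at h₂
  have k₁ : x₁ = 1 / ((e₁ - e₂) * (e₁ - e₃)) := eq_div_of_mul_eq (mul_ne_zero h12 h13) h₁
  have k₂ : x₂ = -1 / ((e₂ - e₃) * (e₁ - e₂)) :=
    eq_div_of_mul_eq (mul_ne_zero h23 h12) (by linear_combination -h₂)
  have k₃ : x₃ = 1 / ((e₁ - e₃) * (e₂ - e₃)) :=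
    eq_div_of_mul_eq (mul_ne_zero h13 h23) (by linear_combination h₃)
  rw [k₁, k₂, k₃]
  refine ⟨?_, ?_, ?_⟩ <;> field_simp <;> ring

theorem cConst_sq_weights (τ : ℍ) :
    cConst τ 1 ^ 2 + cConst τ 2 ^ 2 + cConst τ 3 ^ 2 = 0 ∧
      cConst τ 1 ^ 2 * wp τ (halfPeriod τ 1) + cConst τ 2 ^ 2 * wp τ (halfPeriod τ 2) +
        cConst τ 3 ^ 2 * wp τ (halfPeriod τ 3) = 0 ∧
      cConst τ 1 ^ 2 * wp τ (halfPeriod τ 1) ^ 2 + cConst τ 2 ^ 2 * wp τ (halfPeriod τ 2) ^ 2 +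
        cConst τ 3 ^ 2 * wp τ (halfPeriod τ 3) ^ 2 = 1 :=
  lagrange_weights
    (cConst_sq_mul τ (β := 2) (γ := 3) (by decide) (by decide) (by decide) (by decide)
      (by decide) (by decide))
    (cConst_sq_mul τ (β := 3) (γ := 1) (by decide) (by decide) (by decide) (by decide)
      (by decide) (by decide))
    (cConst_sq_mul τ (β := 1) (γ := 2) (by decide) (by decide) (by decide) (by decide)
      (by decide) (by decide))

theorem cConst_sq_mul_varphi₀ {τ : ℍ} {z : ℂ} (hz : z ∉ (periods τ).lattice) :
    cConst τ 1 ^ 2 * varphi₀ τ 1 z ^ 2 + cConst τ 2 ^ 2 * varphi₀ τ 2 z ^ 2 +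
        cConst τ 3 ^ 2 * varphi₀ τ 3 z ^ 2 = 0 ∧
      cConst τ 1 ^ 2 * varphi₀ τ 1 z ^ 4 + cConst τ 2 ^ 2 * varphi₀ τ 2 z ^ 4 +
        cConst τ 3 ^ 2 * varphi₀ τ 3 z ^ 4 = 1 := by
  obtain ⟨w0, w1, w2⟩ := cConst_sq_weights τ
  have h : ∀ x : ℂ, x ^ 4 = (x ^ 2) ^ 2 := fun x => by ring
  rw [h, h, h, varphi₀_sq (k := 1) (by decide) hz, varphi₀_sq (k := 2) (by decide) hz,
    varphi₀_sq (k := 3) (by decide) hz]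
  constructor
  · linear_combination wp τ z * w0 - w1
  · linear_combination wp τ z ^ 2 * w0 - 2 * wp τ z * w1 + w2

theorem casimir1_S {τ : ℍ} (c η : ℂ) (ν : Fin 4 → ℂ) (p : ℂ) {q : ℂ}
    (hq : 2 * q ∉ (periods τ).lattice) :
    casimir1 (fun a => S τ c η ν a p q) = dual ν 0 ^ 2 := by
  have w0 := (cConst_sq_weights τ).1
  obtain ⟨w1, w2⟩ := cConst_sq_mul_varphi₀ hq
  rw [casimir1, Finset.sum_insert (by decide), Finset.sum_pair (by decide),
    S_of_distinct τ c η ν p q (α := 1) (β := 2) (γ := 3) (by decide) (by decide) (by decide)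
      (by decide) (by decide) (by decide),
    S_of_distinct τ c η ν p q (α := 2) (β := 1) (γ := 3) (by decide) (by decide) (by decide)
      (by decide) (by decide) (by decide),
    S_of_distinct τ c η ν p q (α := 3) (β := 1) (γ := 2) (by decide) (by decide) (by decide)
      (by decide) (by decide) (by decide)]
  generalize varphi₀ τ 1 (2 * q) = f₁ at *
  generalize varphi₀ τ 2 (2 * q) = f₂ at *
  generalize varphi₀ τ 3 (2 * q) = f₃ at *
  obtain ⟨X, hX⟩ : ∃ X, X = (v τ (dual ν) q η * exp (p / (2 * c)) -
    v τ (dual ν) (-q) η * exp (-p / (2 * c))) / 2 +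
      (dual ν 1 * f₁ + dual ν 2 * f₂ + dual ν 3 * f₃) := ⟨_, rfl⟩
  rw [add_comm (dual ν 2 * f₂) (dual ν 1 * f₁), add_assoc (dual ν 3 * f₃),
    add_comm (dual ν 3 * f₃), ← hX]
  linear_combination X ^ 2 * w1 + 2 * X * dual ν 0 * f₁ * f₂ * f₃ * w0 + dual ν 0 ^ 2 *
    ((f₁ ^ 2 * f₂ ^ 2 + f₁ ^ 2 * f₃ ^ 2 + f₂ ^ 2 * f₃ ^ 2) * w0 -
      (f₁ ^ 2 + f₂ ^ 2 + f₃ ^ 2) * w1 + w2)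

theorem casimir2_S {τ : ℍ} (c : ℂ) {η : ℂ} (ν : Fin 4 → ℂ) (p : ℂ) {q : ℂ}
    (hq : 2 * q ∉ (periods τ).lattice) (hη : 2 * η ∉ (periods τ).lattice) :
    casimir2 τ (lam τ ν) (fun a => S τ c η ν a p q) =
      ∑ a : Fin 4, dual ν a ^ 2 * wp τ (η + halfPeriod τ a) -
        ∑ a ∈ ({1, 2, 3} : Finset (Fin 4)), dual ν a ^ 2 * wp τ (halfPeriod τ a) := by
  have w0 := (cConst_sq_weights τ).1
  obtain ⟨w1, w2⟩ := cConst_sq_mul_varphi₀ hq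
  have hC1 := casimir1_S (τ := τ) c η ν p hq
  have hAB := v_mul_v_neg_of_distinct (α := 1) (β := 2) (γ := 3) hq hη (dual ν) (by decide)
    (by decide) (by decide) (by decide) (by decide) (by decide)
  have hEF := exp_div_mul_exp_neg_div c p
  have hl1 : cConst τ 1 * lam τ ν 1 = dual ν 1 := mul_div_cancel₀ _ (cConst_ne_zero τ (by decide))
  have hl2 : cConst τ 2 * lam τ ν 2 = dual ν 2 := mul_div_cancel₀ _ (cConst_ne_zero τ (by decide))
  have hl3 : cConst τ 3 * lam τ ν 3 = dual ν 3 := mul_div_cancel₀ _ (cConst_ne_zero τ (by decide))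
  have k₁ : wp τ (halfPeriod τ 1) = wp τ (2 * q) - varphi₀ τ 1 (2 * q) ^ 2 := by
    rw [varphi₀_sq (by decide) hq]; ring
  have k₂ : wp τ (halfPeriod τ 2) = wp τ (2 * q) - varphi₀ τ 2 (2 * q) ^ 2 := by
    rw [varphi₀_sq (by decide) hq]; ring
  have k₃ : wp τ (halfPeriod τ 3) = wp τ (2 * q) - varphi₀ τ 3 (2 * q) ^ 2 := by
    rw [varphi₀_sq (by decide) hq]; ring
  rw [casimir1, Finset.sum_insert (by decide), Finset.sum_pair (by decide)] at hC1
  rw [casimir2, Finset.sum_insert (by decide), Finset.sum_pair (by decide),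
    Finset.sum_insert (by decide), Finset.sum_pair (by decide), S_zero]
  rw [S_of_distinct τ c η ν p q (α := 1) (β := 2) (γ := 3) (by decide) (by decide) (by decide)
      (by decide) (by decide) (by decide),
    S_of_distinct τ c η ν p q (α := 2) (β := 1) (γ := 3) (by decide) (by decide) (by decide)
      (by decide) (by decide) (by decide),
    S_of_distinct τ c η ν p q (α := 3) (β := 1) (γ := 2) (by decide) (by decide) (by decide)
      (by decide) (by decide) (by decide)] at hC1 ⊢
  rw [k₁, k₂, k₃]
  generalize varphi₀ τ 1 (2 * q) = f₁ at *
  generalize varphi₀ τ 2 (2 * q) = f₂ at *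
  generalize varphi₀ τ 3 (2 * q) = f₃ at *
  generalize exp (p / (2 * c)) = E at *
  generalize exp (-p / (2 * c)) = F at *
  generalize v τ (dual ν) q η = A at *
  generalize v τ (dual ν) (-q) η = B at *
  obtain ⟨X, hX⟩ : ∃ X, X = (A * E - B * F) / 2 +
      (dual ν 1 * f₁ + dual ν 2 * f₂ + dual ν 3 * f₃) := ⟨_, rfl⟩
  rw [add_comm (dual ν 2 * f₂) (dual ν 1 * f₁), add_assoc (dual ν 3 * f₃),
    add_comm (dual ν 3 * f₃), ← hX] at hC1 ⊢
  have hSX : (1 / 2 * (A * E + B * F)) ^ 2 - X ^ 2 + 2 * X * (dual ν 1 * f₁ + dual ν 2 * f₂ +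
      dual ν 3 * f₃) = A * B + (dual ν 1 * f₁ + dual ν 2 * f₂ + dual ν 3 * f₃) ^ 2 := by
    rw [hX]
    linear_combination A * B * hEF
  linear_combination wp τ (2 * q) * hC1 - X ^ 2 * w2 -
    2 * X * dual ν 0 * f₁ * f₂ * f₃ * w1 - dual ν 0 ^ 2 * (f₁ * f₂ * f₃) ^ 2 * w0 + hSX + hAB +
    2 * (f₁ * X + dual ν 0 * (f₂ * f₃)) * hl1 + 2 * (f₂ * X + dual ν 0 * (f₁ * f₃)) * hl2 +
    2 * (f₃ * X + dual ν 0 * (f₁ * f₂)) * hl3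

end BC1

theorem theorem2 (τ : UpperHalfPlane) (c η : ℂ) (ν : Fin 4 → ℂ) (hc : c ≠ 0)
    (hη : 2 * η ∉ (BC1.periods τ).lattice) (p q : ℂ) (hq : 2 * q ∉ (BC1.periods τ).lattice) :
    -- the functions are holomorphic in `(p, q)`, so that the brackets are genuine
    (∀ a : Fin 4, DifferentiableAt ℂ (fun x : ℂ × ℂ => BC1.S τ c η ν a x.1 x.2) (p, q)) ∧
    -- the brackets of the generators
    (∀ α β γ : Fin 4, α ≠ 0 → β ≠ 0 → γ ≠ 0 → α ≠ β → β ≠ γ → α ≠ γ →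
      c * BC1.canonicalBracket (BC1.S τ c η ν α) (BC1.S τ c η ν β) p q =
          -Complex.I * BC1.eps α β γ * BC1.S τ c η ν 0 p q * BC1.S τ c η ν γ p q ∧
      c * BC1.canonicalBracket (BC1.S τ c η ν 0) (BC1.S τ c η ν α) p q =
          -Complex.I * BC1.eps α β γ * BC1.S τ c η ν β p q * BC1.S τ c η ν γ p q *
              (BC1.wp τ (BC1.halfPeriod τ β) - BC1.wp τ (BC1.halfPeriod τ γ)) +
            Complex.I * BC1.eps α β γ *
              (BC1.S τ c η ν β p q * BC1.lam τ ν γ - BC1.lam τ ν β * BC1.S τ c η ν γ p q)) ∧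
    -- the values of the Casimir functions
    BC1.casimir1 (fun a => BC1.S τ c η ν a p q) = BC1.dual ν 0 ^ 2 ∧
    BC1.casimir2 τ (BC1.lam τ ν) (fun a => BC1.S τ c η ν a p q) =
      ∑ a : Fin 4, BC1.dual ν a ^ 2 * BC1.wp τ (η + BC1.halfPeriod τ a) -
        ∑ a ∈ ({1, 2, 3} : Finset (Fin 4)), BC1.dual ν a ^ 2 * BC1.wp τ (BC1.halfPeriod τ a) :=
  ⟨BC1.differentiableAt_S c ν p hq hη,
    fun _ _ _ hα hβ hγ hαβ hβγ hαγ =>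
      ⟨BC1.bracket_S_S hc ν p hq hη hα hβ hγ hαβ hβγ hαγ,
        BC1.bracket_S_zero_S hc ν p hq hη hα hβ hγ hαβ hβγ hαγ⟩,
    BC1.casimir1_S c η ν p hq, BC1.casimir2_S c ν p hq hη⟩
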